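/- All spaces are over $\mathbb{C}$, and locally convex spaces called complete are assumed Hausdorff. A \emph{$\widehat\otimes$-algebra} is a unital associative algebra whose underlying space is a complete locally convex space and whose multiplication is jointly continuous; homomorphisms of $\widehat\otimes$-algebras are continuous and unital. An \emph{$A$-$\widehat\otimes$-bimodule} is a unital $A$-bimodule whose underlying space is complete locally convex and whose left and right multiplications are jointly continuous; morphisms are continuous. For a right $A$-module $X$ and a left $A$-module $Y$, $X\widehat\otimes_A Y$ denotes the completion of the quotient of the complete projective tensor product $X\widehat\otimes Y$ by the closed linear hull of all $x\cdot a\otimes y-x\otimes a\cdot y$. A sequence of $\widehat\otimes$-bimodules is \emph{admissible} if it splits as a sequence of topological vector spaces, i.e. has a contracting homotopy consisting of continuous linear maps. A bimodule $P$ is \emph{projective} if morphisms from $P$ lift along every bimodule morphism that has a continuous linear right inverse. A projective resolution of a bimodule $M$ is an admissible complex $0\leftarrow M\leftarrow P_0\leftarrow P_1\leftarrow\cdots$ of bimodules with all $P_n$ projective. A homomorphism $\varphi\colon A\to B$ of $\widehat\otimes$-algebras is a \emph{homological epimorphism} if it is an epimorphism in the category of $\widehat\otimes$-algebras and the functor $B\widehat\otimes_A(-)\widehat\otimes_A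 B$ sends some (equivalently, each) projective resolution of $A$ in the category of $A$-$\widehat\otimes$-bimodules to an admissible sequence. For an $A$-$\widehat\otimes$-bimodule $X$, $\mathrm{Der}(A,X)$ is the space of continuous derivations $A\to X$. \textbf{Theorem.} Every homological epimorphism $\varphi\colon A\to B$ of $\widehat\otimes$-algebras satisfies Property (UDE): for every $B$-$\widehat\otimes$-bimodule $X$ (regarded also as an $A$-$\widehat\otimes$-bimodule via $\varphi$), the map $\mathrm{Der}(B,X)\to\mathrm{Der}(A,X)$, $D\mapsto D\circ\varphi$, is bijective. -/

import Mathlib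

open scoped TensorProduct

universe u

noncomputable section

/-! ### Complete locally convex spaces and algebras -/

/-- `t` is a locally convex vector space topology on the complex vector space `E`
(not necessarily Hausdorff). -/
structure IsLCTopology (E : Type*) [AddCommGroup E] [Module ℂ E] (t : TopologicalSpace E) :
    Prop where
  addGroup : @IsTopologicalAddGroup E t _
  smul : ContinuousSMul ℂ E
  convex : LocallyConvexSpace ℝ E

/-- `E` is a complete Hausdorff locally convex space over `ℂ`, with its canonical (translation
invariant) uniformity. -/
class CompleteLCS (E : Type*) [AddCommGroup E] [Module ℂ E] [UniformSpace E] : Prop extends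
  IsUniformAddGroup E, ContinuousSMul ℂ E, LocallyConvexSpace ℝ E, CompleteSpace E, T2Space E

/-- `A` is a `⊗̂`-algebra: a unital associative complex algebra whose underlying space is a complete
Hausdorff locally convex space and whose multiplication is jointly continuous. -/
class HatAlgebra (A : Type*) [Ring A] [Algebra ℂ A] [UniformSpace A] : Prop extends
  CompleteLCS A, ContinuousMul A

/-- An `A`-`⊗̂`-bimodule: a unital bimodule over `A` (the right action is an action of `Aᵐᵒᵖ`),
whose underlying space is a complete Hausdorff locally convex space and whose left and right
multiplications `A × X → X`, `X × A → X` are jointly continuous. -/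
structure HatBimod (A : Type u) [Ring A] [Algebra ℂ A] [UniformSpace A] where
  carrier : Type u
  [addCommGroup : AddCommGroup carrier]
  [module : Module ℂ carrier]
  [uniformSpace : UniformSpace carrier]
  [completeLCS : CompleteLCS carrier]
  [leftModule : Module A carrier]
  [rightModule : Module Aᵐᵒᵖ carrier]
  [leftTower : IsScalarTower ℂ A carrier]
  [rightTower : IsScalarTower ℂ Aᵐᵒᵖ carrier]
  [smulComm : SMulCommClass A Aᵐᵒᵖ carrier]
  [leftCont : ContinuousSMul A carrier]
  [rightCont : ContinuousSMul Aᵐᵒᵖ carrier]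

namespace HatBimod

instance (A : Type u) [Ring A] [Algebra ℂ A] [UniformSpace A] :
    CoeSort (HatBimod A) (Type u) := ⟨HatBimod.carrier⟩

attribute [instance] addCommGroup module uniformSpace completeLCS leftModule rightModule
  leftTower rightTower smulComm leftCont rightCont

variable {A B : Type u} [Ring A] [Algebra ℂ A] [UniformSpace A]
  [Ring B] [Algebra ℂ B] [UniformSpace B]

/-- The left action of `a`, `x ↦ a · x`, as a continuous linear operator. -/
def lact (X : HatBimod A) (a : A) : X →L[ℂ] X where
  toFun x := a • x
  map_add' := smul_add a
  map_smul' c x := by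
    rw [RingHom.id_apply, ← algebraMap_smul A c x, ← algebraMap_smul A c (a • x), smul_smul,
      smul_smul, Algebra.commutes]
  cont := continuous_const_smul a

/-- The right action of `a`, `x ↦ x · a`, as a continuous linear operator. -/
def ract (X : HatBimod A) (a : A) : X →L[ℂ] X where
  toFun x := MulOpposite.op a • x
  map_add' := smul_add _
  map_smul' c x := by
    rw [RingHom.id_apply, ← algebraMap_smul Aᵐᵒᵖ c x,
      ← algebraMap_smul Aᵐᵒᵖ c (MulOpposite.op a • x), smul_smul, smul_smul, Algebra.commutes]
  cont := continuous_const_smul _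

@[simp] theorem lact_apply (X : HatBimod A) (a : A) (x : X) : X.lact a x = a • x := rfl

@[simp] theorem ract_apply (X : HatBimod A) (a : A) (x : X) :
    X.ract a x = MulOpposite.op a • x := rfl

/-- A `⊗̂`-algebra as a bimodule over itself. -/
@[reducible] def self (A : Type u) [Ring A] [Algebra ℂ A] [UniformSpace A] [HatAlgebra A] :
    HatBimod A where
  carrier := A

/-- The `A`-bimodule obtained from a `B`-bimodule by restriction of scalars along
`φ : A → B`. -/
@[reducible] def restrict (φ : A →A[ℂ] B) (X : HatBimod B) : HatBimod A :=
  letI l : Module A X := Module.compHom X (φ : A →+* B)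
  letI r : Module Aᵐᵒᵖ X := Module.compHom X (RingHom.op (φ : A →+* B))
  { carrier := X
    leftModule := l
    rightModule := r
    leftTower := ⟨fun c a x => by
      change φ (c • a) • x = c • (φ a • x)
      rw [map_smul, smul_assoc]⟩
    rightTower := ⟨fun c a x => by
      change MulOpposite.op (φ (c • a.unop)) • x = c • (MulOpposite.op (φ a.unop) • x)
      rw [map_smul, MulOpposite.op_smul, smul_assoc]⟩
    smulComm := ⟨fun a a' x => smul_comm (φ a) (MulOpposite.op (φ a'.unop)) x⟩
    leftCont := ⟨(φ.continuous.comp continuous_fst).smul continuous_snd⟩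
    rightCont := ⟨((MulOpposite.continuous_op.comp
      (φ.continuous.comp MulOpposite.continuous_unop)).comp continuous_fst).smul
        continuous_snd⟩ }

/-- Morphisms of `A`-`⊗̂`-bimodules: continuous linear maps commuting with both actions. -/
structure Hom (X Y : HatBimod A) extends X →L[ℂ] Y where
  map_lsmul : ∀ (a : A) (x : X), toFun (a • x) = a • toFun x
  map_rsmul : ∀ (a : A) (x : X), toFun (MulOpposite.op a • x) = MulOpposite.op a • toFun x

/-- `P` is projective in the category of `A`-`⊗̂`-bimodules with the `ℂ`-split exact structure:
morphisms from `P` lift along every morphism `p` that is an admissible epimorphism, i.e. has a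
continuous linear right inverse `s`. -/
def IsProjective (P : HatBimod A) : Prop :=
  ∀ (M N : HatBimod A) (p : Hom M N) (s : N →L[ℂ] M),
    (∀ y, p.toContinuousLinearMap (s y) = y) →
      ∀ f : Hom P N, ∃ g : Hom P M,
        ∀ x, p.toContinuousLinearMap (g.toContinuousLinearMap x) = f.toContinuousLinearMap x

end HatBimod

/-! ### Continuous derivations and Property (UDE) -/

section Derivations

variable {A B : Type u} [Ring A] [Algebra ℂ A] [UniformSpace A]
  [Ring B] [Algebra ℂ B] [UniformSpace B]

/-- The space `Der(A, X)` of continuous derivations from `A` to an `A`-`⊗̂`-bimodule `X`. -/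
def Der (X : HatBimod A) : Submodule ℂ (A →L[ℂ] X) where
  carrier := {D | ∀ a b : A, D (a * b) = a • D b + MulOpposite.op b • D a}
  zero_mem' a b := by simp
  add_mem' {D E} hD hE a b := by
    simp only [add_apply, hD a b, hE a b, smul_add]
    abel
  smul_mem' c D hD a b := by
    have h1 := (X.lact a).map_smul c (D b)
    have h2 := (X.ract b).map_smul c (D a)
    simp only [HatBimod.lact_apply, HatBimod.ract_apply] at h1 h2
    simp only [smul_apply, hD a b, smul_add, h1, h2]

/-- The map `Der(B, X) → Der(A, X)`, `D ↦ D ∘ φ`. -/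
def Der.restrict (φ : A →A[ℂ] B) (X : HatBimod B) : Der X →ₗ[ℂ] Der (X.restrict φ) where
  toFun D := ⟨D.1.comp ⟨φ.toAlgHom.toLinearMap, φ.continuous⟩, fun a b => by
    change D.1 (φ (a * b)) = φ a • D.1 (φ b) + MulOpposite.op (φ b) • D.1 (φ a)
    rw [map_mul]
    exact D.2 (φ a) (φ b)⟩
  map_add' _ _ := rfl
  map_smul' _ _ := rfl

/-- Property (UDE), the unique extension property for derivations. -/
def PropertyUDE (φ : A →A[ℂ] B) : Prop :=
  ∀ X : HatBimod B, Function.Bijective (Der.restrict φ X)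

end Derivations

/-! ### Projective tensor products -/

section Tensor

/-- The algebraic tensor product over `ℂ`, to be endowed with the projective topology. -/
def ProjTensor (X Y : Type*) [AddCommGroup X] [Module ℂ X] [AddCommGroup Y] [Module ℂ Y] :=
  X ⊗[ℂ] Y

variable (X Y : Type*) [AddCommGroup X] [Module ℂ X] [AddCommGroup Y] [Module ℂ Y]

instance : AddCommGroup (ProjTensor X Y) := inferInstanceAs (AddCommGroup (X ⊗[ℂ] Y))
instance : Module ℂ (ProjTensor X Y) := inferInstanceAs (Module ℂ (X ⊗[ℂ] Y))

/-- The canonical bilinear map `X × Y → X ⊗ Y`. -/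
def ProjTensor.mk : X →ₗ[ℂ] Y →ₗ[ℂ] ProjTensor X Y := TensorProduct.mk ℂ X Y

/-- The projective topology: the finest locally convex topology on `X ⊗ Y` for which the canonical
bilinear map `X × Y → X ⊗ Y` is jointly continuous. -/
instance ProjTensor.topology [TopologicalSpace X] [TopologicalSpace Y] :
    TopologicalSpace (ProjTensor X Y) :=
  sInf {t | IsLCTopology (ProjTensor X Y) t ∧
    @Continuous _ _ _ t fun p : X × Y => ProjTensor.mk X Y p.1 p.2}

theorem ProjTensor.isLCTopology [TopologicalSpace X] [TopologicalSpace Y] :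
    IsLCTopology (ProjTensor X Y) (ProjTensor.topology X Y) where
  addGroup := topologicalAddGroup_sInf fun _ ht => ht.1.addGroup
  smul := continuousSMul_sInf fun _ ht => ht.1.smul
  convex := LocallyConvexSpace.sInf fun _ ht => ht.1.convex

instance [TopologicalSpace X] [TopologicalSpace Y] : IsTopologicalAddGroup (ProjTensor X Y) :=
  (ProjTensor.isLCTopology X Y).addGroup

instance [TopologicalSpace X] [TopologicalSpace Y] : ContinuousSMul ℂ (ProjTensor X Y) :=
  (ProjTensor.isLCTopology X Y).smul

theorem ProjTensor.continuous_mk [TopologicalSpace X] [TopologicalSpace Y] :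
    Continuous fun p : X × Y => ProjTensor.mk X Y p.1 p.2 :=
  continuous_sInf_rng.2 fun _ ht => ht.2

variable {X Y}

theorem ProjTensor.continuous_of_mk [TopologicalSpace X] [TopologicalSpace Y]
    {Z : Type*} [AddCommGroup Z] [Module ℂ Z] [tZ : TopologicalSpace Z] (hZ : IsLCTopology Z tZ)
    (f : ProjTensor X Y →ₗ[ℂ] Z)
    (hf : Continuous fun p : X × Y => f (ProjTensor.mk X Y p.1 p.2)) : Continuous f := by
  rw [continuous_iff_le_induced]
  have := hZ.addGroup
  have := hZ.smul
  have := hZ.convex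
  refine sInf_le ⟨⟨topologicalAddGroup_induced f, continuousSMul_induced f, ?_⟩, ?_⟩
  · exact LocallyConvexSpace.induced (f.restrictScalars ℝ)
  · exact continuous_induced_rng.2 hf

/-- Let operators `ρ a` on `X` and `σ a` on `Y` be given, `a ∈ A`. This is the linear hull of all
`ρ a x ⊗ y - x ⊗ σ a y`; if `ρ` is a right and `σ` is a left action of `A`, of all
`x · a ⊗ y - x ⊗ a · y`. -/
def balancedSpan [TopologicalSpace X] [TopologicalSpace Y] {A : Type*}
    (ρ : A → X →L[ℂ] X) (σ : A → Y →L[ℂ] Y) : Submodule ℂ (ProjTensor X Y) :=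
  Submodule.span ℂ {z | ∃ (x : X) (a : A) (y : Y),
    z = ProjTensor.mk X Y (ρ a x) y - ProjTensor.mk X Y x (σ a y)}

/-- The quotient of `X ⊗ Y` (with the projective topology) by `balancedSpan ρ σ`, with the
quotient topology. -/
def PreTensor [TopologicalSpace X] [TopologicalSpace Y] {A : Type*}
    (ρ : A → X →L[ℂ] X) (σ : A → Y →L[ℂ] Y) := ProjTensor X Y ⧸ balancedSpan ρ σ

section

variable [TopologicalSpace X] [TopologicalSpace Y] {A : Type*}
  (ρ : A → X →L[ℂ] X) (σ : A → Y →L[ℂ] Y)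

instance : AddCommGroup (PreTensor ρ σ) :=
  inferInstanceAs (AddCommGroup (ProjTensor X Y ⧸ balancedSpan ρ σ))

instance : Module ℂ (PreTensor ρ σ) :=
  inferInstanceAs (Module ℂ (ProjTensor X Y ⧸ balancedSpan ρ σ))

instance PreTensor.uniformSpace : UniformSpace (PreTensor ρ σ) :=
  IsTopologicalAddGroup.rightUniformSpace (ProjTensor X Y ⧸ balancedSpan ρ σ)

instance : IsUniformAddGroup (PreTensor ρ σ) :=
  isUniformAddGroup_of_addCommGroup (G := ProjTensor X Y ⧸ balancedSpan ρ σ)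

instance : ContinuousSMul ℂ (PreTensor ρ σ) :=
  inferInstanceAs (ContinuousSMul ℂ (ProjTensor X Y ⧸ balancedSpan ρ σ))

instance : UniformContinuousConstSMul ℂ (PreTensor ρ σ) :=
  uniformContinuousConstSMul_of_continuousConstSMul ℂ _

/-- The completed projective tensor product `X ⊗̂_A Y` of a right `A`-module `X` and a left
`A`-module `Y`, the actions being given by the operators `ρ a : x ↦ x · a` and `σ a : y ↦ a · y`.
The completion is the Hausdorff completion, so it does not matter whether `balancedSpan ρ σ` or
its closure is divided out, nor whether `X ⊗ Y` is completed before passing to the quotient. -/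
abbrev HatTensor := UniformSpace.Completion (PreTensor ρ σ)

/-- The quotient map `X ⊗ Y → PreTensor ρ σ`. -/
def PreTensor.mk : ProjTensor X Y →L[ℂ] PreTensor ρ σ where
  toLinearMap := (balancedSpan ρ σ).mkQ
  cont := continuous_quotient_mk' (X := ProjTensor X Y)

/-- The canonical map `X ⊗ Y → X ⊗̂_A Y`, whose range is dense. -/
def HatTensor.ofProj : ProjTensor X Y →L[ℂ] HatTensor ρ σ where
  toFun z := UniformSpace.Completion.coe' (PreTensor.mk ρ σ z)
  map_add' z w := by rw [map_add, UniformSpace.Completion.coe_add]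
  map_smul' c z := by rw [map_smul, UniformSpace.Completion.coe_smul, RingHom.id_apply]
  cont := (UniformSpace.Completion.continuous_coe (PreTensor ρ σ)).comp (PreTensor.mk ρ σ).continuous

/-- The elementary tensor `x ⊗ y` in `X ⊗̂_A Y`. -/
def HatTensor.tmul (x : X) (y : Y) : HatTensor ρ σ :=
  HatTensor.ofProj ρ σ (ProjTensor.mk X Y x y)

variable {ρ σ}

theorem HatTensor.tmul_balanced (x : X) (a : A) (y : Y) :
    HatTensor.tmul ρ σ (ρ a x) y = HatTensor.tmul ρ σ x (σ a y) := by
  have h : PreTensor.mk ρ σ (ProjTensor.mk X Y (ρ a x) y) =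
      PreTensor.mk ρ σ (ProjTensor.mk X Y x (σ a y)) :=
    (Submodule.Quotient.eq _).2 (Submodule.subset_span ⟨x, a, y, rfl⟩)
  exact congrArg UniformSpace.Completion.coe' h

/-- Continuous linear maps on `X ⊗̂_A Y` are determined by their values on elementary tensors. -/
theorem HatTensor.ext_tmul {Z : Type*} [AddCommGroup Z] [Module ℂ Z] [TopologicalSpace Z]
    [T2Space Z] {f g : HatTensor ρ σ →L[ℂ] Z}
    (h : ∀ x y, f (HatTensor.tmul ρ σ x y) = g (HatTensor.tmul ρ σ x y)) : f = g := by
  have h1 : f.toLinearMap.comp (HatTensor.ofProj ρ σ).toLinearMap =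
      g.toLinearMap.comp (HatTensor.ofProj ρ σ).toLinearMap :=
    TensorProduct.ext' h
  ext z
  induction z using UniformSpace.Completion.induction_on with
  | hp => exact isClosed_eq f.continuous g.continuous
  | ih z =>
    obtain ⟨w, rfl⟩ := Submodule.Quotient.mk_surjective (balancedSpan ρ σ) z
    exact LinearMap.congr_fun h1 w

variable {X' Y' : Type*} [AddCommGroup X'] [Module ℂ X'] [AddCommGroup Y'] [Module ℂ Y']
  [TopologicalSpace X'] [TopologicalSpace Y']
  {ρ' : A → X' →L[ℂ] X'} {σ' : A → Y' →L[ℂ] Y'}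

/-- The map `f ⊗ g : X ⊗ Y → X' ⊗ Y'`. -/
def ProjTensor.map (f : X →L[ℂ] X') (g : Y →L[ℂ] Y') : ProjTensor X Y →L[ℂ] ProjTensor X' Y' where
  toLinearMap := TensorProduct.map f.toLinearMap g.toLinearMap
  cont := ProjTensor.continuous_of_mk (ProjTensor.isLCTopology X' Y')
    (TensorProduct.map f.toLinearMap g.toLinearMap) <|
      (ProjTensor.continuous_mk X' Y').comp
        ((f.continuous.comp continuous_fst).prodMk (g.continuous.comp continuous_snd))

theorem ProjTensor.map_mk (f : X →L[ℂ] X') (g : Y →L[ℂ] Y') (x : X) (y : Y) :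
    ProjTensor.map f g (ProjTensor.mk X Y x y) = ProjTensor.mk X' Y' (f x) (g y) := rfl

/-- The map `f ⊗ g` on the quotients `PreTensor`, for `f` and `g` commuting with the actions. -/
def PreTensor.map (f : X →L[ℂ] X') (g : Y →L[ℂ] Y') (hf : ∀ a x, f (ρ a x) = ρ' a (f x))
    (hg : ∀ a y, g (σ a y) = σ' a (g y)) : PreTensor ρ σ →L[ℂ] PreTensor ρ' σ' where
  toLinearMap := Submodule.mapQ (balancedSpan ρ σ) (balancedSpan ρ' σ')
    (ProjTensor.map f g).toLinearMap <| by
      refine Submodule.span_le.2 ?_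
      rintro _ ⟨x, a, y, rfl⟩
      refine Submodule.subset_span ⟨f x, a, g y, ?_⟩
      change ProjTensor.map f g _ = _
      rw [map_sub, ProjTensor.map_mk, ProjTensor.map_mk, hf, hg]
  cont := by
    refine continuous_quot_lift _ ?_
    exact (continuous_quotient_mk' (X := ProjTensor X' Y')).comp (ProjTensor.map f g).continuous

/-- The map `f ⊗̂_A g : X ⊗̂_A Y → X' ⊗̂_A Y'`, for `f` and `g` commuting with the actions. -/
def HatTensor.map (f : X →L[ℂ] X') (g : Y →L[ℂ] Y') (hf : ∀ a x, f (ρ a x) = ρ' a (f x))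
    (hg : ∀ a y, g (σ a y) = σ' a (g y)) : HatTensor ρ σ →L[ℂ] HatTensor ρ' σ' :=
  (PreTensor.map f g hf hg).completion

theorem HatTensor.map_tmul (f : X →L[ℂ] X') (g : Y →L[ℂ] Y') (hf : ∀ a x, f (ρ a x) = ρ' a (f x))
    (hg : ∀ a y, g (σ a y) = σ' a (g y)) (x : X) (y : Y) :
    HatTensor.map f g hf hg (HatTensor.tmul ρ σ x y) = HatTensor.tmul ρ' σ' (f x) (g y) :=
  ContinuousLinearMap.completion_apply_coe (PreTensor.map f g hf hg) _

end

end Tensor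

/-! ### The functor `B ⊗̂_A (-) ⊗̂_A B` -/

section Functor

variable {A B : Type u} [Ring A] [Algebra ℂ A] [UniformSpace A]
  [Ring B] [Algebra ℂ B] [UniformSpace B] [HatAlgebra B] (φ : A →A[ℂ] B)

/-- `B` as an `A`-bimodule via `φ`. -/
abbrev overBimod : HatBimod A := (HatBimod.self B).restrict φ

/-- The space `B ⊗̂_A P`. -/
abbrev LeftInduced (P : HatBimod A) := HatTensor (overBimod φ).ract P.lact

/-- The map `1 ⊗̂_A f : B ⊗̂_A P → B ⊗̂_A Q` for a continuous linear map `f : P → Q` that commutes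
with the left actions of `A`. -/
def LeftInduced.map {P Q : HatBimod A} (f : P →L[ℂ] Q) (hf : ∀ a x, f (P.lact a x) = Q.lact a (f x)) :
    LeftInduced φ P →L[ℂ] LeftInduced φ Q :=
  HatTensor.map (ContinuousLinearMap.id ℂ (overBimod φ)) f (fun _ _ => rfl) hf

/-- The right action of `a ∈ A` on `B ⊗̂_A P`, determined by `(b ⊗ p) · a = b ⊗ (p · a)`. -/
def LeftInduced.ract (P : HatBimod A) (a : A) : LeftInduced φ P →L[ℂ] LeftInduced φ P :=
  LeftInduced.map φ (P.ract a) fun a' x => (smul_comm a' (MulOpposite.op a) x).symm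

/-- The space `(B ⊗̂_A P) ⊗̂_A B`. -/
abbrev Induced (P : HatBimod A) := HatTensor (LeftInduced.ract φ P) (overBimod φ).lact

/-- The map `1 ⊗̂_A f ⊗̂_A 1 : B ⊗̂_A P ⊗̂_A B → B ⊗̂_A Q ⊗̂_A B` for a bimodule morphism `f`. -/
def Induced.map {P Q : HatBimod A} (f : HatBimod.Hom P Q) : Induced φ P →L[ℂ] Induced φ Q :=
  HatTensor.map (LeftInduced.map φ f.toContinuousLinearMap f.map_lsmul)
    (ContinuousLinearMap.id ℂ (overBimod φ))
    (fun a z => by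
      have h : (LeftInduced.map φ f.toContinuousLinearMap f.map_lsmul).comp
            (LeftInduced.ract φ P a) =
          (LeftInduced.ract φ Q a).comp
            (LeftInduced.map φ f.toContinuousLinearMap f.map_lsmul) := by
        refine HatTensor.ext_tmul fun b p => ?_
        simp only [ContinuousLinearMap.comp_apply, LeftInduced.map, LeftInduced.ract]
        erw [HatTensor.map_tmul, HatTensor.map_tmul, HatTensor.map_tmul, HatTensor.map_tmul]
        exact congrArg (HatTensor.tmul _ _ b) (f.map_rsmul a p)
      exact congrArg (fun T => T z) h)
    (fun _ _ => rfl)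

end Functor

/-! ### Projective resolutions and homological epimorphisms -/

section Homological

/-- The augmented sequence `0 ← E ← X 0 ← X 1 ← ⋯` of topological vector spaces splits, i.e. has a
contracting homotopy consisting of continuous linear maps. -/
def SplitsOverC (E : Type*) (X : ℕ → Type*) [AddCommGroup E] [Module ℂ E] [TopologicalSpace E]
    [∀ n, AddCommGroup (X n)] [∀ n, Module ℂ (X n)] [∀ n, TopologicalSpace (X n)]
    (ε : X 0 →L[ℂ] E) (d : ∀ n, X (n + 1) →L[ℂ] X n) : Prop :=
  ∃ (r : E →L[ℂ] X 0) (s : ∀ n, X n →L[ℂ] X (n + 1)),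
    (∀ e, ε (r e) = e) ∧
    (∀ x, r (ε x) + d 0 (s 0 x) = x) ∧
    ∀ n x, s n (d n x) + d (n + 1) (s (n + 1) x) = x

/-- A projective resolution `0 ← M ← P 0 ← P 1 ← ⋯` of the `A`-`⊗̂`-bimodule `M`: a complex of
bimodules in which all `P n` are projective and which splits over `ℂ`. Resolutions of finite
length are continued by zero bimodules. -/
structure ProjectiveResolution {A : Type u} [Ring A] [Algebra ℂ A] [UniformSpace A]
    (M : HatBimod A) where
  P : ℕ → HatBimod A
  ε : HatBimod.Hom (P 0) M
  d : ∀ n, HatBimod.Hom (P (n + 1)) (P n)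
  projective : ∀ n, (P n).IsProjective
  ε_d : ∀ x, ε.toContinuousLinearMap ((d 0).toContinuousLinearMap x) = 0
  d_d : ∀ n x, (d n).toContinuousLinearMap ((d (n + 1)).toContinuousLinearMap x) = 0
  splits : SplitsOverC M (fun n => P n) ε.toContinuousLinearMap
    fun n => (d n).toContinuousLinearMap

variable {A B : Type u} [Ring A] [Algebra ℂ A] [UniformSpace A]
  [Ring B] [Algebra ℂ B] [UniformSpace B]

/-- `φ` is an epimorphism in the category of `⊗̂`-algebras. -/
def IsHatEpi (φ : A →A[ℂ] B) : Prop :=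
  ∀ (C : Type u) [Ring C] [Algebra ℂ C] [UniformSpace C] [HatAlgebra C] (g h : B →A[ℂ] C),
    g.comp φ = h.comp φ → g = h

/-- `φ : A → B` is a homological epimorphism: it is an epimorphism of `⊗̂`-algebras and `A` is
acyclic relative to the functor `B ⊗̂_A (-) ⊗̂_A B`, i.e. this functor sends some projective
resolution of the `A`-bimodule `A` to a sequence that splits over `ℂ`. -/
def IsHomologicalEpi [HatAlgebra A] [HatAlgebra B] (φ : A →A[ℂ] B) : Prop :=
  IsHatEpi φ ∧ ∃ R : ProjectiveResolution (HatBimod.self A),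
    SplitsOverC (Induced φ (HatBimod.self A)) (fun n => Induced φ (R.P n))
      (Induced.map φ R.ε) fun n => Induced.map φ (R.d n)

end Homological

end

/-! Injectivity uses only that `φ` is an epimorphism. A derivation `D : B → X` is the same as a
homomorphism `b ↦ (b, D b)` into the square-zero extension of `B` by `X`, so two derivations that
agree on `φ(A)` give homomorphisms that agree after composition with `φ`, hence are equal
(`IsHatEpi.restrict_injective`). Applied to `b ↦ b ⊗ 1 - 1 ⊗ b`, this gives `b ⊗ 1 = 1 ⊗ b` in `B
⊗̂_A B` (`IsHatEpi.tmul_one_eq_one_tmul`). The analysis of tensor topologies serves mainly to make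
the actions of `B` on `B ⊗̂_A B` jointly continuous, so that this space is a legitimate coefficient
bimodule.

For surjectivity, let `D : A → X` be a derivation and `P₀ ← P₁ ← P₂` the start of the given
resolution, with augmentation `ε : P₀ → A`. Twisting the right action on `X × A` by `D` gives an
extension of `A` by `X`; lifting `ε` to it by projectivity of `P₀` yields `γ : P₀ → X`, left linear,
with `γ(p·a) = γ(p)·a + ε(p)·D(a)` (`exists_twisted_lift`). The defect vanishes on `ker ε`, so `γ ∘
d` is a bimodule morphism `P₁ → X` vanishing on the image of `P₂`. Since the sequence `B ⊗̂_A P ⊗̂_A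
B` splits, `γ ∘ d` induces a continuous linear `ψ : B ⊗̂_A P₀ ⊗̂_A B → X` that respects both
`B`-actions on the kernel of the augmentation (`Induced.exists_extension`).

Choose `p` with `ε p = 1`. The elements `b ⊗ p ⊗ 1 - 1 ⊗ p ⊗ b` lie in that kernel because `b ⊗ 1 =
1 ⊗ b`, so `b ↦ b·γ(p) - γ(p)·b - ψ(b ⊗ p ⊗ 1 - 1 ⊗ p ⊗ b)` is a derivation of `B`. At `φ a` the
last term is `γ(a·p - p·a) = a·γ(p) - γ(p)·a - D(a)`, and the value is `D(a)`. -/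

noncomputable section

open Topology Filter UniformSpace

/-! ### Completions of locally convex spaces. -/

section CompletionLCS

variable {E : Type*} [AddCommGroup E] [UniformSpace E] [IsUniformAddGroup E]

/-- A map which is additive in both variables, continuous in the second variable, and jointly
continuous on a dense subgroup in the second variable, is jointly continuous. -/
theorem UniformSpace.Completion.continuous_bilin {G Z : Type*} [AddCommGroup G]
    [TopologicalSpace G] [IsTopologicalAddGroup G] [AddCommGroup Z] [UniformSpace Z]
    [IsUniformAddGroup Z] [T2Space Z] [CompleteSpace Z] (m : G → Completion E → Z)
    (hadd : ∀ g h (e : E), m (g + h) e = m g e + m h e)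
    (hadd' : ∀ g (e e' : E), m g ↑(e + e') = m g e + m g e')
    (hc : ∀ g, Continuous (m g)) (hm : Continuous fun p : G × E => m p.1 p.2) :
    Continuous fun p : G × Completion E => m p.1 p.2 := by
  let f : G →+ E →+ Z := AddMonoidHom.mk' (fun g => AddMonoidHom.mk' (fun e => m g e) (hadd' g))
    fun g h => by ext e; exact hadd g h e
  have de : IsDenseInducing (AddMonoidHom.id G) := (IsDenseEmbedding.id (α := G)).isDenseInducing
  have df : IsDenseInducing (Completion.toCompl : E →+ Completion E) :=
    Completion.isDenseInducing_coe
  have hf : Continuous fun p : G × E => f p.1 p.2 := hm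
  -- The extension of `f` by density is jointly continuous. For fixed `g` it agrees with `m g`,
  -- since both are continuous and coincide on the dense image of `E`.
  have key := IsDenseInducing.extend_Z_bilin de df hf
  convert key using 1
  ext ⟨g, z⟩
  change m g z = _
  induction z using Completion.induction_on with
  | hp => exact isClosed_eq (hc g) (key.comp (by fun_prop : Continuous fun z => (g, z)))
  | ih e => exact ((de.prodMap df).extend_eq_at (a := (g, e)) hf.continuousAt).symm

variable [Module ℂ E] [UniformContinuousConstSMul ℂ E]

instance UniformSpace.Completion.continuousSMul_complex [ContinuousSMul ℂ E] :
    ContinuousSMul ℂ (Completion E) where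
  continuous_smul := by
    refine Completion.continuous_bilin (fun c z => c • z) (fun c d z => add_smul c d _)
      (fun c z w => ?_) (fun c => continuous_const_smul c) ?_
    · rw [Completion.coe_add, smul_add]
    · simp_rw [← Completion.coe_smul]
      exact (Completion.continuous_coe E).comp continuous_smul

/-- Closures of the images of a convex basis at zero form a basis at zero of the completion, and
closures of convex sets are convex. -/
theorem UniformSpace.Completion.locallyConvexSpace [ContinuousSMul ℂ E]
    [LocallyConvexSpace ℝ E] : LocallyConvexSpace ℝ (Completion E) := by
  have hb := (LocallyConvexSpace.convex_basis_zero ℝ E).hasBasis_of_isDenseInducing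
    (Completion.isDenseInducing_coe (α := E))
  refine LocallyConvexSpace.ofBasisZero ℝ (Completion E) _ _ ((Completion.coe_zero (α := E)) ▸ hb) ?_
  rintro s ⟨-, hs⟩
  refine Convex.closure ?_
  rintro _ ⟨x, hx, rfl⟩ _ ⟨y, hy, rfl⟩ a b ha hb hab
  refine ⟨a • x + b • y, hs hx hy ha hb hab, ?_⟩
  rw [Completion.coe_add]
  congr 1
  · exact Completion.coe_smul (a : ℂ) x
  · exact Completion.coe_smul (b : ℂ) y

theorem UniformSpace.Completion.completeLCS [ContinuousSMul ℂ E] [LocallyConvexSpace ℝ E] :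
    CompleteLCS (Completion E) where
  toLocallyConvexSpace := Completion.locallyConvexSpace

end CompletionLCS

/-! ### Seminorms and joint continuity for the projective topology. -/

section ProjTensorSeminorm

variable {X Y : Type*} [AddCommGroup X] [Module ℂ X] [AddCommGroup Y] [Module ℂ Y]

@[elab_as_elim]
theorem ProjTensor.induction {motive : ProjTensor X Y → Prop} (z : ProjTensor X Y)
    (mk : ∀ x y, motive (ProjTensor.mk X Y x y))
    (add : ∀ z w, motive z → motive w → motive (z + w)) : motive z :=
  TensorProduct.induction_on z 
    -- Zero is the elementary tensor `0 ⊗ 0`, so no separate case for it is needed.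
    (by have h := mk 0 0; rwa [map_zero] at h) mk add


/-- The homomorphism of additive groups underlying the canonical bilinear map. -/
def ProjTensor.mkAddHom (X Y : Type*) [AddCommGroup X] [Module ℂ X] [AddCommGroup Y]
    [Module ℂ Y] : X →+ Y →+ ProjTensor X Y :=
  AddMonoidHom.mk' (fun x => (ProjTensor.mk X Y x).toAddMonoidHom) fun x x' => by
    ext y; exact LinearMap.map_add₂ (ProjTensor.mk X Y) x x' y

theorem ProjTensor.seminorm_mk_smul_smul (q : Seminorm ℂ (ProjTensor X Y)) (x : X) (y : Y)
    (c d : ℂ) : q (ProjTensor.mk X Y (c • x) (d • y)) = ‖c‖ * ‖d‖ * q (ProjTensor.mk X Y x y) := by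
  rw [map_smul, LinearMap.map_smul₂, map_smul_eq_mul, map_smul_eq_mul]
  ring

variable [TopologicalSpace X] [TopologicalSpace Y]

instance ProjTensor.locallyConvexSpace : LocallyConvexSpace ℝ (ProjTensor X Y) :=
  (ProjTensor.isLCTopology X Y).convex

/-- Neighbourhoods of zero are absorbent. This moves a fixed vector into a neighbourhood where a
bound is known; `c ≠ 0` allows dividing the factor out again. -/
theorem exists_smul_mem_of_mem_nhds_zero [ContinuousSMul ℂ X] {U : Set X} (hU : U ∈ 𝓝 0) (x : X) :
    ∃ c : ℂ, c ≠ 0 ∧ c • x ∈ U :=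
  (eventually_mem_nhdsWithin.and
    ((absorbent_nhds_zero hU (𝕜 := ℂ)).eventually_nhdsNE_zero x)).exists

theorem eventually_smul_mem_nhds_zero [ContinuousSMul ℂ X] {U : Set X} (hU : U ∈ 𝓝 0) (c : ℂ) :
    ∀ᶠ x in 𝓝 (0 : X), c • x ∈ U :=
  (continuous_const_smul c).tendsto' 0 0 (smul_zero c) hU

variable [ContinuousSMul ℂ X] [ContinuousSMul ℂ Y]

/-- A seminorm on `X ⊗ Y` that is bounded on `U ⊗ V` for some neighbourhoods of zero `U`, `V`
is continuous in the projective topology. -/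
theorem ProjTensor.continuous_seminorm [IsTopologicalAddGroup X] [IsTopologicalAddGroup Y]
    (q : Seminorm ℂ (ProjTensor X Y)) {U : Set X} {V : Set Y}
    (hU : U ∈ 𝓝 0) (hV : V ∈ 𝓝 0) (h : ∀ x ∈ U, ∀ y ∈ V, q (ProjTensor.mk X Y x y) ≤ 1) :
    Continuous q := by
  -- The topology defined by `q` alone is locally convex. Once the canonical bilinear map is jointly
  -- continuous for it, it is one of the topologies whose infimum is the projective topology.
  let F : SeminormFamily ℂ (ProjTensor X Y) Unit := fun _ => q
  let t : TopologicalSpace (ProjTensor X Y) := F.moduleFilterBasis.topology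
  have ht : @WithSeminorms _ _ _ _ _ _ F t := @WithSeminorms.mk _ _ _ _ _ _ _ t rfl
  have hlc : IsLCTopology (ProjTensor X Y) t :=
    ⟨ht.topologicalAddGroup, ht.continuousSMul, ht.toLocallyConvexSpace⟩
  have key (x : X) (y : Y) (c d : ℂ) (hc : c • x ∈ U) (hd : d • y ∈ V) :
      ‖c‖ * ‖d‖ * q (ProjTensor.mk X Y x y) ≤ 1 := by
    rw [← seminorm_mk_smul_smul]
    exact h _ hc _ hd
  -- The scaling factor `2 / (ε * c)` turns the bound by `1` into `r ≤ ε / 2`, which gives the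
  -- strict inequality.
  have lt_of_le {c r ε : ℝ} (hc : 0 < c) (hε : 0 < ε) (h : c * (2 / (ε * c)) * r ≤ 1) :
      r < ε := by
    have : c * (2 / (ε * c)) * r = 2 * r / ε := by field_simp
    rw [this, div_le_one hε] at h
    linarith
  have hle : ProjTensor.topology X Y ≤ t := by
    refine sInf_le ⟨hlc, ?_⟩
    have := hlc.addGroup
    refine @continuous_of_continuousAt_zero₂ X _ _ _ Y (ProjTensor X Y) _ t _ _ _ _
      (mkAddHom X Y) ?_ ?_ ?_
    · refine (ht.tendsto_nhds _ _).2 fun _ ε hε => ?_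
      rw [nhds_prod_eq]
      filter_upwards [prod_mem_prod hU (eventually_smul_mem_nhds_zero hV ((2 / (ε * 1) : ℝ) : ℂ))]
        with p hp
      have := key p.1 p.2 1 _ (by simpa using hp.1) hp.2
      rw [Complex.norm_of_nonneg (by positivity), norm_one] at this
      simpa [mkAddHom, F] using lt_of_le one_pos hε this
    · intro x
      obtain ⟨c, hc, hx⟩ := exists_smul_mem_of_mem_nhds_zero hU x
      have hc' := norm_pos_iff.2 hc
      refine (ht.tendsto_nhds _ _).2 fun _ ε hε => ?_
      filter_upwards [eventually_smul_mem_nhds_zero hV ((2 / (ε * ‖c‖) : ℝ) : ℂ)] with y hy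
      have := key x y c _ hx hy
      rw [Complex.norm_of_nonneg (by positivity)] at this
      simpa [mkAddHom, F] using lt_of_le hc' hε this
    · intro y
      obtain ⟨c, hc, hy⟩ := exists_smul_mem_of_mem_nhds_zero hV y
      have hc' := norm_pos_iff.2 hc
      refine (ht.tendsto_nhds _ _).2 fun _ ε hε => ?_
      filter_upwards [eventually_smul_mem_nhds_zero hU ((2 / (ε * ‖c‖) : ℝ) : ℂ)] with x hx
      have := key x y _ c hx hy
      rw [Complex.norm_of_nonneg (by positivity), mul_comm (2 / _)] at this
      simpa [mkAddHom, F] using lt_of_le hc' hε this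
  exact continuous_le_dom hle (@WithSeminorms.continuous_seminorm _ _ _ _ _ _ t F ht ())

open scoped ComplexOrder in
-- Nonnegative elements of `ℂ` in its partial order are real, so convexity over `ℂ` and over `ℝ`
-- coincide.
theorem LocallyConvexSpace.complex_of_real (Z : Type*) [AddCommGroup Z] [Module ℂ Z]
    [TopologicalSpace Z] [LocallyConvexSpace ℝ Z] : LocallyConvexSpace ℂ Z where
  convex_basis z := by
    simpa only [convex_RCLike_iff_convex_real] using LocallyConvexSpace.convex_basis (𝕜 := ℝ) z

/-- A family of linear maps on `X ⊗ Y`, depending linearly on a parameter, is jointly continuous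
in the projective topology if it is jointly continuous on elementary tensors. -/
theorem ProjTensor.continuous_bilin [IsTopologicalAddGroup X] [IsTopologicalAddGroup Y]
    {G Z : Type*} [AddCommGroup G] [Module ℂ G]
    [TopologicalSpace G] [IsTopologicalAddGroup G] [ContinuousSMul ℂ G] [AddCommGroup Z]
    [Module ℂ Z] [TopologicalSpace Z] [IsTopologicalAddGroup Z] [ContinuousSMul ℂ Z]
    [LocallyConvexSpace ℝ Z] (m : G →ₗ[ℂ] ProjTensor X Y →ₗ[ℂ] Z)
    (hm : Continuous fun p : G × X × Y => m p.1 (ProjTensor.mk X Y p.2.1 p.2.2)) :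
    Continuous fun p : G × ProjTensor X Y => m p.1 p.2 := by
  have := LocallyConvexSpace.complex_of_real Z
  have : ContinuousSMul ℝ Z := IsScalarTower.continuousSMul ℂ
  let M : G →+ ProjTensor X Y →+ Z := AddMonoidHom.mk' (fun g => (m g).toAddMonoidHom)
    fun g g' => by ext y; exact LinearMap.map_add₂ _ g g' y
  -- For a biadditive map, joint continuity reduces to continuity at the origin and on the two
  -- families of slices. Only the origin requires a bound uniform in `g`.
  refine continuous_of_continuousAt_zero₂ M ?_ (fun g => ?_) fun z => ?_
  · refine ((PolynormableSpace.withSeminorms ℂ Z).tendsto_nhds _ _).2 fun ⟨p, hp⟩ ε hε => ?_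
    have h0 : ∀ᶠ w : G × X × Y in 𝓝 (0, 0, 0),
        p (m w.1 (ProjTensor.mk X Y w.2.1 w.2.2)) < 1 :=
      ((hp.comp hm).tendsto' _ 0 (by simp)).eventually_lt_const one_pos
    rw [nhds_prod_eq, nhds_prod_eq, eventually_prod_iff] at h0
    obtain ⟨N, hN, UV, hUV, h0⟩ := h0
    obtain ⟨U, hU, V, hV, hUV⟩ := eventually_prod_iff.1 hUV
    let q : {g // N g} → Seminorm ℂ (ProjTensor X Y) := fun g => p.comp (m g)
    have hmk (g : {g // N g}) {x : X} {y : Y} (hx : U x) (hy : V y) :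
        q g (ProjTensor.mk X Y x y) ≤ 1 := (h0 g.2 (hUV hx hy)).le
    -- Pointwise boundedness makes the supremum of the `q g` a genuine pointwise supremum. An
    -- elementary tensor scales into `U ⊗ V`, where every `q g` is at most `1`; sums follow from the
    -- triangle inequality.
    have hbdd : BddAbove (Set.range q) := by
      refine Seminorm.bddAbove_range_iff.2 fun z => ?_
      induction z using ProjTensor.induction with
      | mk x y =>
        obtain ⟨c, hc, hx⟩ := exists_smul_mem_of_mem_nhds_zero hU x
        obtain ⟨d, hd, hy⟩ := exists_smul_mem_of_mem_nhds_zero hV y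
        refine ⟨1 / (‖c‖ * ‖d‖), ?_⟩
        rintro _ ⟨g, rfl⟩
        have hc' := norm_pos_iff.2 hc
        have hd' := norm_pos_iff.2 hd
        have := hmk g hx hy
        rw [seminorm_mk_smul_smul] at this
        rwa [le_div_iff₀' (by positivity)]
      | add z w hz hw =>
        obtain ⟨a, ha⟩ := hz
        obtain ⟨b, hb⟩ := hw
        refine ⟨a + b, ?_⟩
        rintro _ ⟨g, rfl⟩
        exact (map_add_le_add (q g) z w).trans (add_le_add (ha ⟨g, rfl⟩) (hb ⟨g, rfl⟩))
    have : Nonempty {g // N g} := ⟨⟨0, hN.self_of_nhds⟩⟩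
    -- `Q` is continuous, being bounded by `1` on `U ⊗ V`, and it dominates every `q g` with `g`
    -- near zero at once.
    let Q : Seminorm ℂ (ProjTensor X Y) := ⨆ g, q g
    have hq : Continuous Q := continuous_seminorm Q hU hV fun x hx y hy => by
      rw [Seminorm.iSup_apply hbdd]
      exact ciSup_le fun g => hmk g hx hy
    rw [nhds_prod_eq]
    filter_upwards [prod_mem_prod hN ((hq.tendsto' 0 0 (map_zero Q)).eventually_lt_const hε)]
      with w hw
    have h1 : q ⟨w.1, hw.1⟩ w.2 ≤ Q w.2 := by
      rw [Seminorm.iSup_apply hbdd]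
      exact le_ciSup (Seminorm.bddAbove_range_iff.1 hbdd w.2) _
    have h2 : p (m w.1 w.2) < ε := h1.trans_lt hw.2
    simpa [M] using h2
  · exact (continuous_of_mk ⟨inferInstance, inferInstance, inferInstance⟩ (m g)
      (hm.comp (by fun_prop : Continuous fun w : X × Y => (g, w)))).continuousAt
  · refine Continuous.continuousAt (f := fun g => m g z) ?_
    induction z using ProjTensor.induction with
    | mk x y => exact hm.comp (by fun_prop : Continuous fun g : G => (g, x, y))
    | add z w hz hw => exact (hz.add hw).congr fun g => ((m g).map_add z w).symm

end ProjTensorSeminorm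

/-! ### Universal property of `X ⊗̂_A Y` and operators on it. -/

section TensorLift

variable {X Y : Type*} [AddCommGroup X] [Module ℂ X] [AddCommGroup Y] [Module ℂ Y]
  [TopologicalSpace X] [TopologicalSpace Y] {A : Type*}
  {ρ : A → X →L[ℂ] X} {σ : A → Y →L[ℂ] Y}

theorem PreTensor.isOpenQuotientMap_mk : IsOpenQuotientMap (PreTensor.mk ρ σ) :=
  QuotientAddGroup.isOpenQuotientMap_mk (N := (balancedSpan ρ σ).toAddSubgroup)

instance PreTensor.locallyConvexSpace : LocallyConvexSpace ℝ (PreTensor ρ σ) := by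
  have hb := (LocallyConvexSpace.convex_basis_zero ℝ (ProjTensor X Y)).map (PreTensor.mk ρ σ)
  rw [PreTensor.isOpenQuotientMap_mk.map_nhds_eq, map_zero] at hb
  refine LocallyConvexSpace.ofBasisZero ℝ _ _ _ hb ?_
  rintro s ⟨-, hs⟩
  exact hs.linear_image ((PreTensor.mk ρ σ).toLinearMap.restrictScalars ℝ)

instance HatTensor.completeLCS : CompleteLCS (HatTensor ρ σ) :=
  Completion.completeLCS

theorem HatTensor.tmul_add (x : X) (y y' : Y) :
    HatTensor.tmul ρ σ x (y + y') = HatTensor.tmul ρ σ x y + HatTensor.tmul ρ σ x y' := by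
  simp only [HatTensor.tmul, map_add]

theorem HatTensor.add_tmul (x x' : X) (y : Y) :
    HatTensor.tmul ρ σ (x + x') y = HatTensor.tmul ρ σ x y + HatTensor.tmul ρ σ x' y :=
  (congrArg _ ((ProjTensor.mk X Y).map_add₂ x x' y)).trans (map_add (HatTensor.ofProj ρ σ) _ _)

theorem HatTensor.tmul_smul (c : ℂ) (x : X) (y : Y) :
    HatTensor.tmul ρ σ x (c • y) = c • HatTensor.tmul ρ σ x y := by
  simp only [HatTensor.tmul, map_smul]

theorem HatTensor.smul_tmul (c : ℂ) (x : X) (y : Y) :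
    HatTensor.tmul ρ σ (c • x) y = c • HatTensor.tmul ρ σ x y :=
  (congrArg _ ((ProjTensor.mk X Y).map_smul₂ c x y)).trans (map_smul (HatTensor.ofProj ρ σ) _ _)

theorem HatTensor.continuous_tmul_comp {W : Type*} [TopologicalSpace W] {f : W → X} {g : W → Y}
    (hf : Continuous f) (hg : Continuous g) :
    Continuous fun w => HatTensor.tmul ρ σ (f w) (g w) :=
  (HatTensor.ofProj ρ σ).continuous.comp ((ProjTensor.continuous_mk X Y).comp (hf.prodMk hg))

/-- The continuous linear map `y ↦ x ⊗ y`. -/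
def HatTensor.tmulLeft (ρ : A → X →L[ℂ] X) (σ : A → Y →L[ℂ] Y) (x : X) :
    Y →L[ℂ] HatTensor ρ σ :=
  (HatTensor.ofProj ρ σ).comp
    ⟨ProjTensor.mk X Y x, (ProjTensor.continuous_mk X Y).comp (Continuous.prodMk_right x)⟩

/-- The continuous linear map `x ↦ x ⊗ y`. -/
def HatTensor.tmulRight (ρ : A → X →L[ℂ] X) (σ : A → Y →L[ℂ] Y) (y : Y) :
    X →L[ℂ] HatTensor ρ σ :=
  (HatTensor.ofProj ρ σ).comp
    ⟨(ProjTensor.mk X Y).flip y, (ProjTensor.continuous_mk X Y).comp (Continuous.prodMk_left y)⟩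

section Lift

instance CompleteLCS.uniformContinuousConstSMul (Z : Type*) [AddCommGroup Z] [Module ℂ Z]
    [UniformSpace Z] [CompleteLCS Z] : UniformContinuousConstSMul ℂ Z :=
  uniformContinuousConstSMul_of_continuousConstSMul ℂ Z

variable {Z : Type*} [AddCommGroup Z] [Module ℂ Z] [UniformSpace Z] [CompleteLCS Z]

/-- A balanced linear map on `X ⊗ Y`, continuous on elementary tensors, as a continuous linear map
on `PreTensor ρ σ`. -/
def PreTensor.lift (β : X →ₗ[ℂ] Y →ₗ[ℂ] Z) (hβ : Continuous fun p : X × Y => β p.1 p.2)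
    (hb : ∀ x a y, β (ρ a x) y = β x (σ a y)) : PreTensor ρ σ →L[ℂ] Z where
  toLinearMap := (balancedSpan ρ σ).liftQ (TensorProduct.lift β) <| by
    refine Submodule.span_le.2 ?_
    rintro _ ⟨x, a, y, rfl⟩
    change TensorProduct.lift β (ρ a x ⊗ₜ[ℂ] y - x ⊗ₜ[ℂ] σ a y) = 0
    rw [map_sub, TensorProduct.lift.tmul, TensorProduct.lift.tmul, hb, sub_self]
  cont := continuous_quot_lift _ <| ProjTensor.continuous_of_mk
    ⟨inferInstance, inferInstance, inferInstance⟩ (TensorProduct.lift β) hβ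

/-- The continuous linear map on `X ⊗̂_A Y` induced by a jointly continuous balanced bilinear
map. -/
def HatTensor.lift (β : X →ₗ[ℂ] Y →ₗ[ℂ] Z) (hβ : Continuous fun p : X × Y => β p.1 p.2)
    (hb : ∀ x a y, β (ρ a x) y = β x (σ a y)) : HatTensor ρ σ →L[ℂ] Z :=
  (PreTensor.lift β hβ hb).fromCompletion

theorem HatTensor.lift_tmul (β : X →ₗ[ℂ] Y →ₗ[ℂ] Z) (hβ : Continuous fun p : X × Y => β p.1 p.2)
    (hb : ∀ x a y, β (ρ a x) y = β x (σ a y)) (x : X) (y : Y) :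
    HatTensor.lift β hβ hb (HatTensor.tmul ρ σ x y) = β x y :=
  ContinuousLinearMap.fromCompletion_apply_coe (PreTensor.lift β hβ hb) _

/-- A family of continuous linear maps on `X ⊗̂_A Y`, depending linearly on a parameter, is jointly
continuous if it is jointly continuous on elementary tensors. -/
theorem HatTensor.continuous_bilin [IsTopologicalAddGroup X] [ContinuousSMul ℂ X]
    [IsTopologicalAddGroup Y] [ContinuousSMul ℂ Y] {G : Type*} [AddCommGroup G] [Module ℂ G]
    [TopologicalSpace G] [IsTopologicalAddGroup G] [ContinuousSMul ℂ G]
    (m : G →ₗ[ℂ] HatTensor ρ σ →L[ℂ] Z)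
    (hm : Continuous fun p : G × X × Y => m p.1 (HatTensor.tmul ρ σ p.2.1 p.2.2)) :
    Continuous fun p : G × HatTensor ρ σ => m p.1 p.2 := by
  refine Completion.continuous_bilin (fun g z => m g z)
    (fun g h e => by simp) (fun g e e' => by simp [Completion.coe_add])
    (fun g => (m g).continuous) ?_
  -- Openness matters: the product of the identity with a mere quotient map need not be a quotient
  -- map.
  refine ((IsOpenQuotientMap.id (X := G)).prodMap
    (PreTensor.isOpenQuotientMap_mk (ρ := ρ) (σ := σ))).isQuotientMap.continuous_iff.2 ?_
  exact ProjTensor.continuous_bilin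
    (LinearMap.mk₂ ℂ (fun g z => m g (HatTensor.ofProj ρ σ z)) (by simp) (by simp) (by simp)
      (by simp)) hm

end Lift

/-- The map `f ⊗̂_A 1` for an operator `f` commuting with `ρ`. -/
def HatTensor.mapLeft (f : X →L[ℂ] X) (hf : ∀ a x, f (ρ a x) = ρ a (f x)) :
    HatTensor ρ σ →L[ℂ] HatTensor ρ σ :=
  HatTensor.map f (ContinuousLinearMap.id ℂ Y) hf fun _ _ => rfl

/-- The map `1 ⊗̂_A g` for an operator `g` commuting with `σ`. -/
def HatTensor.mapRight (g : Y →L[ℂ] Y) (hg : ∀ a y, g (σ a y) = σ a (g y)) :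
    HatTensor ρ σ →L[ℂ] HatTensor ρ σ :=
  HatTensor.map (ContinuousLinearMap.id ℂ X) g (fun _ _ => rfl) hg

theorem HatTensor.mapLeft_tmul (f : X →L[ℂ] X) (hf : ∀ a x, f (ρ a x) = ρ a (f x))
    (x : X) (y : Y) :
    HatTensor.mapLeft (σ := σ) f hf (HatTensor.tmul ρ σ x y) = HatTensor.tmul ρ σ (f x) y :=
  HatTensor.map_tmul _ _ _ _ x y

theorem HatTensor.mapRight_tmul (g : Y →L[ℂ] Y) (hg : ∀ a y, g (σ a y) = σ a (g y))
    (x : X) (y : Y) :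
    HatTensor.mapRight (ρ := ρ) g hg (HatTensor.tmul ρ σ x y) = HatTensor.tmul ρ σ x (g y) :=
  HatTensor.map_tmul _ _ _ _ x y

variable (ρ σ) in
/-- Operators on `X` commuting with `ρ` act on `X ⊗̂_A Y`. -/
def HatTensor.actLeft {R : Type*} [Ring R] [Algebra ℂ R] [IsTopologicalAddGroup X]
    [ContinuousConstSMul ℂ X] (f : R →ₐ[ℂ] X →L[ℂ] X)
    (hf : ∀ r a x, f r (ρ a x) = ρ a (f r x)) :
    R →ₐ[ℂ] HatTensor ρ σ →L[ℂ] HatTensor ρ σ :=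
  AlgHom.ofLinearMap
    { toFun r := HatTensor.mapLeft (f r) (hf r)
      map_add' r s := HatTensor.ext_tmul fun x y => by
        rw [add_apply, mapLeft_tmul, mapLeft_tmul, mapLeft_tmul, ← add_tmul, map_add, add_apply]
      map_smul' c r := HatTensor.ext_tmul fun x y => by
        rw [RingHom.id_apply, smul_apply, mapLeft_tmul, mapLeft_tmul, ← smul_tmul, map_smul,
          smul_apply] }
    (HatTensor.ext_tmul fun x y => by
      change HatTensor.mapLeft (f 1) _ _ = tmul ρ σ x y
      rw [mapLeft_tmul, map_one, one_apply_eq_self])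
    fun r s => HatTensor.ext_tmul fun x y => by
      change HatTensor.mapLeft (f (r * s)) _ _ =
        HatTensor.mapLeft (f r) _ (HatTensor.mapLeft (f s) _ _)
      rw [mapLeft_tmul, mapLeft_tmul, mapLeft_tmul, map_mul, mul_apply_eq_comp]

variable (ρ σ) in
/-- Operators on `Y` commuting with `σ` act on `X ⊗̂_A Y`. -/
def HatTensor.actRight {R : Type*} [Ring R] [Algebra ℂ R] [IsTopologicalAddGroup Y]
    [ContinuousConstSMul ℂ Y] (g : R →ₐ[ℂ] Y →L[ℂ] Y)
    (hg : ∀ r a y, g r (σ a y) = σ a (g r y)) :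
    R →ₐ[ℂ] HatTensor ρ σ →L[ℂ] HatTensor ρ σ :=
  AlgHom.ofLinearMap
    { toFun r := HatTensor.mapRight (g r) (hg r)
      map_add' r s := HatTensor.ext_tmul fun x y => by
        rw [add_apply, mapRight_tmul, mapRight_tmul, mapRight_tmul, ← tmul_add, map_add,
          add_apply]
      map_smul' c r := HatTensor.ext_tmul fun x y => by
        rw [RingHom.id_apply, smul_apply, mapRight_tmul, mapRight_tmul, ← tmul_smul, map_smul,
          smul_apply] }
    (HatTensor.ext_tmul fun x y => by
      change HatTensor.mapRight (g 1) _ _ = tmul ρ σ x y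
      rw [mapRight_tmul, map_one, one_apply_eq_self])
    fun r s => HatTensor.ext_tmul fun x y => by
      change HatTensor.mapRight (g (r * s)) _ _ =
        HatTensor.mapRight (g r) _ (HatTensor.mapRight (g s) _ _)
      rw [mapRight_tmul, mapRight_tmul, mapRight_tmul, map_mul, mul_apply_eq_comp]

theorem HatTensor.actLeft_tmul {R : Type*} [Ring R] [Algebra ℂ R] [IsTopologicalAddGroup X]
    [ContinuousConstSMul ℂ X] (f : R →ₐ[ℂ] X →L[ℂ] X)
    (hf : ∀ r a x, f r (ρ a x) = ρ a (f r x)) (r : R) (x : X) (y : Y) :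
    HatTensor.actLeft ρ σ f hf r (HatTensor.tmul ρ σ x y) = HatTensor.tmul ρ σ (f r x) y :=
  HatTensor.map_tmul _ _ _ _ x y

theorem HatTensor.actRight_tmul {R : Type*} [Ring R] [Algebra ℂ R] [IsTopologicalAddGroup Y]
    [ContinuousConstSMul ℂ Y] (g : R →ₐ[ℂ] Y →L[ℂ] Y)
    (hg : ∀ r a y, g r (σ a y) = σ a (g r y)) (r : R) (x : X) (y : Y) :
    HatTensor.actRight ρ σ g hg r (HatTensor.tmul ρ σ x y) = HatTensor.tmul ρ σ x (g r y) :=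
  HatTensor.map_tmul _ _ _ _ x y

end TensorLift

/-! ### Bimodules from commuting actions. -/

namespace HatBimod

variable {A : Type u} [Ring A] [Algebra ℂ A] [UniformSpace A]

/-- The left action of `A` on a bimodule. -/
def lactHom (X : HatBimod A) : A →ₐ[ℂ] X →L[ℂ] X :=
  AlgHom.ofLinearMap
    { toFun := X.lact
      map_add' a b := by ext x; exact add_smul a b x
      map_smul' c a := by ext x; exact smul_assoc c a x }
    (by ext x; exact one_smul A x) fun a b => by ext x; exact mul_smul a b x

/-- The right action of `A` on a bimodule. -/
def ractHom (X : HatBimod A) : Aᵐᵒᵖ →ₐ[ℂ] X →L[ℂ] X :=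
  AlgHom.ofLinearMap
    { toFun a := X.ract a.unop
      map_add' a b := by ext x; exact add_smul a b x
      map_smul' c a := by ext x; exact smul_assoc c a x }
    (by ext x; exact one_smul Aᵐᵒᵖ x) fun a b => by ext x; exact mul_smul a b x

/-- The bimodule given by two commuting jointly continuous actions. -/
@[reducible] def ofActions (T : Type u) [AddCommGroup T] [Module ℂ T] [UniformSpace T]
    [CompleteLCS T]
    (l : A →ₐ[ℂ] T →L[ℂ] T) (r : Aᵐᵒᵖ →ₐ[ℂ] T →L[ℂ] T)
    (hl : Continuous fun p : A × T => l p.1 p.2) (hr : Continuous fun p : Aᵐᵒᵖ × T => r p.1 p.2)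
    (hlr : ∀ a b t, l a (r b t) = r b (l a t)) : HatBimod A :=
  letI : Module A T := Module.compHom T
    (ContinuousLinearMap.toLinearMapRingHom.comp (l : A →+* T →L[ℂ] T))
  letI : Module Aᵐᵒᵖ T := Module.compHom T
    (ContinuousLinearMap.toLinearMapRingHom.comp (r : Aᵐᵒᵖ →+* T →L[ℂ] T))
  { carrier := T
    leftTower := ⟨fun c a t => congrArg (fun f : T →L[ℂ] T => f t) (map_smul l c a)⟩
    rightTower := ⟨fun c a t => congrArg (fun f : T →L[ℂ] T => f t) (map_smul r c a)⟩
    smulComm := ⟨hlr⟩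
    leftCont := ⟨hl⟩
    rightCont := ⟨hr⟩ }

end HatBimod

/-! ### Square-zero extensions of algebras and twisted extensions of bimodules. -/

section Extensions

instance CompleteLCS.prod (E F : Type*) [AddCommGroup E] [Module ℂ E] [UniformSpace E]
    [CompleteLCS E] [AddCommGroup F] [Module ℂ F] [UniformSpace F] [CompleteLCS F] :
    CompleteLCS (E × F) where
  toLocallyConvexSpace := Prod.locallyConvexSpace

variable {A B : Type u} [Ring A] [Algebra ℂ A] [UniformSpace A]
  [Ring B] [Algebra ℂ B] [UniformSpace B]

instance HatBimod.hatAlgebra_trivSqZeroExt [HatAlgebra B] (X : HatBimod B) :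
    HatAlgebra (TrivSqZeroExt B X) where
  toLocallyConvexSpace := (CompleteLCS.prod B X).toLocallyConvexSpace

theorem Der.map_mul {X : HatBimod A} (D : Der X) (a b : A) :
    D.1 (a * b) = a • D.1 b + MulOpposite.op b • D.1 a :=
  D.2 a b

theorem Der.map_one {X : HatBimod A} (D : Der X) : D.1 1 = 0 := by
  have h := Der.map_mul D 1 1
  rw [mul_one, one_smul, MulOpposite.op_one, one_smul] at h
  exact left_eq_add.1 h

/-- A derivation `D` as the homomorphism `b ↦ (b, D b)` into the trivial square-zero extension. -/
def Der.toTrivSqZeroExt [HatAlgebra B] {X : HatBimod B} (D : Der X) :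
    B →A[ℂ] TrivSqZeroExt B X where
  toAlgHom := AlgHom.ofLinearMap
    { toFun b := TrivSqZeroExt.inl b + TrivSqZeroExt.inr (D.1 b)
      map_add' a b := TrivSqZeroExt.ext (by simp) (by simp)
      map_smul' c a := TrivSqZeroExt.ext (by simp) (by simp) }
    (TrivSqZeroExt.ext (by simp) (by simp [Der.map_one]))
    fun a b => TrivSqZeroExt.ext (by simp) (by simp [Der.map_mul])
  cont := TrivSqZeroExt.continuous_inl.add (TrivSqZeroExt.continuous_inr.comp D.1.continuous)

theorem Der.snd_toTrivSqZeroExt [HatAlgebra B] {X : HatBimod B} (D : Der X) (b : B) :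
    (Der.toTrivSqZeroExt D b).snd = D.1 b :=
  zero_add _

/-- The homomorphisms `b ↦ (b, D b)` and `b ↦ (b, E b)` into the square-zero extension agree after
composition with `φ`, hence agree. -/
theorem IsHatEpi.restrict_injective [HatAlgebra B] {φ : A →A[ℂ] B} (hφ : IsHatEpi φ)
    (X : HatBimod B) : Function.Injective (Der.restrict φ X) := by
  intro D E h
  have key : (Der.toTrivSqZeroExt D).comp φ = (Der.toTrivSqZeroExt E).comp φ := by
    refine DFunLike.ext _ _ fun a => TrivSqZeroExt.ext rfl ?_
    exact (Der.snd_toTrivSqZeroExt D (φ a)).trans ((congrArg (fun F => F.1 a) h).trans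
      (Der.snd_toTrivSqZeroExt E (φ a)).symm)
  refine Subtype.ext (ContinuousLinearMap.ext fun b => ?_)
  rw [← Der.snd_toTrivSqZeroExt D, hφ _ _ _ key, Der.snd_toTrivSqZeroExt E]

/-- The right action `(y, b) · a = (y · a + b · D a, b a)` on `Y × A`. -/
def Der.twistedRact [HatAlgebra A] {Y : HatBimod A} (D : Der Y) (a : Aᵐᵒᵖ) :
    (Y × A) →L[ℂ] (Y × A) where
  toFun z := (a • z.1 + z.2 • D.1 a.unop, z.2 * a.unop)
  map_add' z w := Prod.ext
    (by simp only [Prod.fst_add, Prod.snd_add, smul_add, add_smul]; abel) (add_mul _ _ _)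
  map_smul' c z := Prod.ext
    (by
      have h := (Y.ract a.unop).map_smul c z.1
      simp only [HatBimod.ract_apply, MulOpposite.op_unop] at h
      simp only [Prod.smul_fst, Prod.smul_snd, smul_add, smul_assoc, h, RingHom.id_apply])
    (smul_mul_assoc c _ _)
  cont := by fun_prop

/-- The extension of `A` by `Y` with the right action `(y, b) · a = (y · a + b · D a, b a)`. -/
@[reducible] def HatBimod.twistedExt [HatAlgebra A] (Y : HatBimod A) (D : Der Y) : HatBimod A :=
  HatBimod.ofActions (Y × A)
    (AlgHom.ofLinearMap
      { toFun a := (Y.lact a).prodMap ((HatBimod.self A).lact a)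
        map_add' a b := ContinuousLinearMap.ext fun z =>
          Prod.ext (add_smul a b z.1) (add_mul a b z.2)
        map_smul' c a := ContinuousLinearMap.ext fun z =>
          Prod.ext (smul_assoc c a z.1) (smul_mul_assoc c a z.2) }
      (ContinuousLinearMap.ext fun z => Prod.ext (one_smul A z.1) (one_mul z.2))
      fun a b => ContinuousLinearMap.ext fun z =>
        Prod.ext (mul_smul a b z.1) (mul_assoc a b z.2))
    (AlgHom.ofLinearMap
      { toFun := Der.twistedRact D
        map_add' a b := ContinuousLinearMap.ext fun z => Prod.ext
          (by
            change (a + b) • z.1 + z.2 • D.1 (a + b).unop =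
              (a • z.1 + z.2 • D.1 a.unop) + (b • z.1 + z.2 • D.1 b.unop)
            simp only [add_smul, MulOpposite.unop_add, map_add, smul_add]
            abel)
          (mul_add _ _ _)
        map_smul' c a := ContinuousLinearMap.ext fun z => Prod.ext
          (by
            change (c • a) • z.1 + z.2 • D.1 (c • a).unop = c • (a • z.1 + z.2 • D.1 a.unop)
            have h := (Y.lact z.2).map_smul c (D.1 a.unop)
            simp only [HatBimod.lact_apply] at h
            rw [smul_assoc, MulOpposite.unop_smul, map_smul, h, smul_add])
          (mul_smul_comm c _ _) }
      (ContinuousLinearMap.ext fun z => Prod.ext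
        (by
          change (1 : Aᵐᵒᵖ) • z.1 + z.2 • D.1 (1 : Aᵐᵒᵖ).unop = z.1
          rw [one_smul, MulOpposite.unop_one, Der.map_one D, smul_zero, add_zero])
        (mul_one z.2))
      -- Multiplicativity of the twisted action is exactly the Leibniz rule for `D`.
      fun a b => ContinuousLinearMap.ext fun z => Prod.ext
        (by
          change (a * b) • z.1 + z.2 • D.1 (a * b).unop =
            a • (b • z.1 + z.2 • D.1 b.unop) + (z.2 * b.unop) • D.1 a.unop
          rw [MulOpposite.unop_mul, Der.map_mul D, MulOpposite.op_unop, smul_add, smul_add,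
            mul_smul, mul_smul, smul_comm z.2 a]
          abel)
        (mul_assoc _ _ _).symm)
    (by
      change Continuous fun p : A × (Y × A) => (p.1 • p.2.1, p.1 * p.2.2)
      fun_prop)
    (by
      change Continuous fun p : Aᵐᵒᵖ × (Y × A) =>
        (p.1 • p.2.1 + p.2.2 • D.1 p.1.unop, p.2.2 * p.1.unop)
      fun_prop)
    fun a b z => Prod.ext
      (by
        change a • (b • z.1 + z.2 • D.1 b.unop) = b • a • z.1 + (a * z.2) • D.1 b.unop
        rw [smul_add, smul_comm a b, mul_smul])
      (mul_assoc a _ _).symm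

/-- The projection of the twisted extension onto `A` is a bimodule morphism, and `y = 0` splits it
linearly, though in general not as bimodules. Hence `ε` lifts to the extension; `γ` is the
`Y`-component of the lift, and the twist produces its defect of right linearity. -/
theorem HatBimod.IsProjective.exists_twisted_lift [HatAlgebra A] {P Y : HatBimod A}
    (hP : P.IsProjective) (ε : HatBimod.Hom P (HatBimod.self A)) (D : Der Y) :
    ∃ γ : P →L[ℂ] Y, (∀ (a : A) (p : P), γ (a • p) = a • γ p) ∧
      ∀ (a : A) (p : P), γ (MulOpposite.op a • p) =
        MulOpposite.op a • γ p + (ε.toContinuousLinearMap p : A) • D.1 a := by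
  obtain ⟨g, hg⟩ := hP (Y.twistedExt D) (HatBimod.self A)
    { toContinuousLinearMap := ContinuousLinearMap.snd ℂ Y A
      map_lsmul := fun a x => rfl
      map_rsmul := fun a x => rfl }
    (ContinuousLinearMap.inr ℂ Y A) (fun _ => rfl) ε
  refine ⟨(ContinuousLinearMap.fst ℂ Y A).comp g.toContinuousLinearMap,
    fun a p => ?_, fun a p => ?_⟩
  · exact congrArg Prod.fst (g.map_lsmul a p)
  · rw [← hg p]
    exact congrArg Prod.fst (g.map_rsmul a p)

end Extensions

/-! ### The `B`-bimodule `B ⊗̂_A B` of an epimorphism. -/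

section InducedBimodules

variable {A B : Type u} [Ring A] [Algebra ℂ A] [UniformSpace A]
  [Ring B] [Algebra ℂ B] [UniformSpace B] [HatAlgebra B] (φ : A →A[ℂ] B)

/-- The left action of `B` on `B ⊗̂_A B`. -/
def tensorSquareLact :
    B →ₐ[ℂ] HatTensor (overBimod φ).ract (overBimod φ).lact →L[ℂ]
      HatTensor (overBimod φ).ract (overBimod φ).lact :=
  HatTensor.actLeft (overBimod φ).ract (overBimod φ).lact (HatBimod.self B).lactHom
    fun b a x => (mul_assoc b x (φ a)).symm

/-- The right action of `B` on `B ⊗̂_A B`. -/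
def tensorSquareRact :
    Bᵐᵒᵖ →ₐ[ℂ] HatTensor (overBimod φ).ract (overBimod φ).lact →L[ℂ]
      HatTensor (overBimod φ).ract (overBimod φ).lact :=
  HatTensor.actRight (overBimod φ).ract (overBimod φ).lact (HatBimod.self B).ractHom
    fun b a x => mul_assoc (φ a) x b.unop

theorem tensorSquareLact_tmul (b x y : B) :
    tensorSquareLact φ b (HatTensor.tmul (overBimod φ).ract (overBimod φ).lact x y) =
      HatTensor.tmul (overBimod φ).ract (overBimod φ).lact (b * x : B) y :=
  HatTensor.actLeft_tmul _ _ _ _ _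

theorem tensorSquareRact_tmul (b : Bᵐᵒᵖ) (x y : B) :
    tensorSquareRact φ b (HatTensor.tmul (overBimod φ).ract (overBimod φ).lact x y) =
      HatTensor.tmul (overBimod φ).ract (overBimod φ).lact x (y * b.unop : B) :=
  HatTensor.actRight_tmul _ _ _ _ _

theorem continuous_tensorSquareLact :
    Continuous fun p : B × HatTensor (overBimod φ).ract (overBimod φ).lact =>
      tensorSquareLact φ p.1 p.2 := by
  refine HatTensor.continuous_bilin (tensorSquareLact φ).toLinearMap ?_
  have h1 : Continuous fun p : B × B × B => p.1 * p.2.1 := by fun_prop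
  have h2 : Continuous fun p : B × B × B => p.2.2 := by fun_prop
  exact (HatTensor.continuous_tmul_comp (X := overBimod φ) (Y := overBimod φ) h1 h2).congr
    fun p => (tensorSquareLact_tmul φ _ _ _).symm

theorem continuous_tensorSquareRact :
    Continuous fun p : Bᵐᵒᵖ × HatTensor (overBimod φ).ract (overBimod φ).lact =>
      tensorSquareRact φ p.1 p.2 := by
  have : IsTopologicalAddGroup Bᵐᵒᵖ := { }
  refine HatTensor.continuous_bilin (tensorSquareRact φ).toLinearMap ?_
  have h1 : Continuous fun p : Bᵐᵒᵖ × B × B => p.2.1 := by fun_prop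
  have h2 : Continuous fun p : Bᵐᵒᵖ × B × B => p.2.2 * p.1.unop := by fun_prop
  exact (HatTensor.continuous_tmul_comp (X := overBimod φ) (Y := overBimod φ) h1 h2).congr
    fun p => (tensorSquareRact_tmul φ _ _ _).symm

theorem tensorSquareLact_ract_comm (a : B) (b : Bᵐᵒᵖ)
    (t : HatTensor (overBimod φ).ract (overBimod φ).lact) :
    tensorSquareLact φ a (tensorSquareRact φ b t) =
      tensorSquareRact φ b (tensorSquareLact φ a t) := by
  have h : (tensorSquareLact φ a).comp (tensorSquareRact φ b) =
      (tensorSquareRact φ b).comp (tensorSquareLact φ a) := HatTensor.ext_tmul fun x y => by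
    rw [ContinuousLinearMap.comp_apply, ContinuousLinearMap.comp_apply, tensorSquareRact_tmul,
      tensorSquareLact_tmul, tensorSquareLact_tmul, tensorSquareRact_tmul]
  exact congrArg (fun F => F t) h

/-- The `B`-bimodule `B ⊗̂_A B`. -/
@[reducible] def tensorSquare : HatBimod B :=
  HatBimod.ofActions (HatTensor (overBimod φ).ract (overBimod φ).lact)
    (tensorSquareLact φ) (tensorSquareRact φ) (continuous_tensorSquareLact φ)
    (continuous_tensorSquareRact φ) (tensorSquareLact_ract_comm φ)

variable {φ}

/-- If `φ` is an epimorphism, then `b ⊗ 1 = 1 ⊗ b` in `B ⊗̂_A B`. -/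
theorem IsHatEpi.tmul_one_eq_one_tmul (hφ : IsHatEpi φ) (b : B) :
    HatTensor.tmul (overBimod φ).ract (overBimod φ).lact b (1 : B) =
      HatTensor.tmul (overBimod φ).ract (overBimod φ).lact (1 : B) b := by
  let ρ := (overBimod φ).ract
  let σ := (overBimod φ).lact
  -- The derivation `b ↦ b ⊗ 1 - 1 ⊗ b` vanishes on `φ(A)` because the tensor product is balanced
  -- over `A`, so it is zero.
  let δ : Der (tensorSquare φ) :=
    ⟨HatTensor.tmulRight ρ σ (1 : B) - HatTensor.tmulLeft ρ σ (1 : B), fun b c => by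
      change HatTensor.tmul ρ σ (b * c : B) (1 : B) - HatTensor.tmul ρ σ (1 : B) (b * c : B) =
        tensorSquareLact φ b (HatTensor.tmul ρ σ c (1 : B) - HatTensor.tmul ρ σ (1 : B) c) +
          tensorSquareRact φ (MulOpposite.op c)
            (HatTensor.tmul ρ σ b (1 : B) - HatTensor.tmul ρ σ (1 : B) b)
      rw [map_sub, map_sub, tensorSquareLact_tmul, tensorSquareLact_tmul, tensorSquareRact_tmul,
        tensorSquareRact_tmul, MulOpposite.unop_op, mul_one, one_mul]
      exact (sub_add_sub_cancel _ _ _).symm⟩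
  have hδ : δ = 0 := by
    refine hφ.restrict_injective _ (Subtype.ext (ContinuousLinearMap.ext fun a => ?_))
    change HatTensor.tmul ρ σ (φ a) (1 : B) - HatTensor.tmul ρ σ (1 : B) (φ a) = 0
    have := HatTensor.tmul_balanced (ρ := ρ) (σ := σ) (1 : B) a (1 : B)
    have h1 : ρ a (1 : B) = φ a := one_mul (φ a)
    have h2 : σ a (1 : B) = φ a := mul_one (φ a)
    rw [h1, h2] at this
    exact sub_eq_zero.2 this
  exact sub_eq_zero.1 (congrArg (fun F : Der (tensorSquare φ) => F.1 b) hδ)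

end InducedBimodules

/-! ### Calculus of `B ⊗̂_A P ⊗̂_A B`. -/

section Induced

variable {A B : Type u} [Ring A] [Algebra ℂ A] [UniformSpace A]
  [Ring B] [Algebra ℂ B] [UniformSpace B] [HatAlgebra B] (φ : A →A[ℂ] B)

/-- The elementary tensor `b ⊗ p` in `B ⊗̂_A P`. -/
def LeftInduced.tmul (P : HatBimod A) (b : B) (p : P) : LeftInduced φ P :=
  HatTensor.tmul (overBimod φ).ract P.lact b p

/-- The elementary tensor `b ⊗ p ⊗ b'` in `B ⊗̂_A P ⊗̂_A B`. -/
def Induced.tmul (P : HatBimod A) (b : B) (p : P) (b' : B) : Induced φ P :=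
  HatTensor.tmul (LeftInduced.ract φ P) (overBimod φ).lact (LeftInduced.tmul φ P b p) b'

variable {φ} {P Q : HatBimod A}

theorem LeftInduced.map_tmul (f : P →L[ℂ] Q) (hf : ∀ a x, f (P.lact a x) = Q.lact a (f x))
    (b : B) (p : P) : LeftInduced.map φ f hf (LeftInduced.tmul φ P b p) =
      LeftInduced.tmul φ Q b (f p) :=
  HatTensor.map_tmul _ _ _ _ _ _

theorem LeftInduced.ract_tmul (a : A) (b : B) (p : P) :
    LeftInduced.ract φ P a (LeftInduced.tmul φ P b p) =
      LeftInduced.tmul φ P b (MulOpposite.op a • p) :=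
  LeftInduced.map_tmul _ _ _ _

theorem Induced.map_tmul (f : HatBimod.Hom P Q) (b : B) (p : P) (b' : B) :
    Induced.map φ f (Induced.tmul φ P b p b') =
      Induced.tmul φ Q b (f.toContinuousLinearMap p) b' :=
  (HatTensor.map_tmul _ _ _ _ _ _).trans
    (congrArg (fun z => HatTensor.tmul (LeftInduced.ract φ Q) (overBimod φ).lact z b')
      (LeftInduced.map_tmul _ _ b p))

theorem LeftInduced.ext {Z : Type*} [AddCommGroup Z] [Module ℂ Z] [TopologicalSpace Z]
    [T2Space Z] {f g : LeftInduced φ P →L[ℂ] Z}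
    (h : ∀ b p, f (LeftInduced.tmul φ P b p) = g (LeftInduced.tmul φ P b p)) : f = g :=
  HatTensor.ext_tmul h

theorem Induced.ext {Z : Type*} [AddCommGroup Z] [Module ℂ Z] [TopologicalSpace Z]
    [T2Space Z] {f g : Induced φ P →L[ℂ] Z}
    (h : ∀ b p b', f (Induced.tmul φ P b p b') = g (Induced.tmul φ P b p b')) : f = g := by
  refine HatTensor.ext_tmul fun z b' => ?_
  have : f.comp (HatTensor.tmulRight (LeftInduced.ract φ P) (overBimod φ).lact b') =
      g.comp (HatTensor.tmulRight (LeftInduced.ract φ P) (overBimod φ).lact b') :=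
    LeftInduced.ext fun b p => h b p b'
  exact congrArg (fun F => F z) this

theorem Induced.tmul_smul_left (b : B) (a : A) (p : P) (b' : B) :
    Induced.tmul φ P b (a • p) b' = Induced.tmul φ P (b * φ a) p b' :=
  congrArg (fun z => HatTensor.tmul (LeftInduced.ract φ P) (overBimod φ).lact z b')
    (HatTensor.tmul_balanced (ρ := (overBimod φ).ract) (σ := P.lact) b a p).symm

theorem Induced.tmul_smul_right (b : B) (a : A) (p : P) (b' : B) :
    Induced.tmul φ P b (MulOpposite.op a • p) b' = Induced.tmul φ P b p (φ a * b') :=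
  (congrArg (fun z => HatTensor.tmul (LeftInduced.ract φ P) (overBimod φ).lact z b')
    (LeftInduced.ract_tmul a b p).symm).trans (HatTensor.tmul_balanced _ a _)

theorem Induced.tmul_sub (b : B) (p q : P) (b' : B) :
    Induced.tmul φ P b (p - q) b' = Induced.tmul φ P b p b' - Induced.tmul φ P b q b' :=
  map_sub ((HatTensor.tmulRight (LeftInduced.ract φ P) (overBimod φ).lact b').comp
    (HatTensor.tmulLeft (overBimod φ).ract P.lact b)) p q

variable (φ P)

/-- The left action of `B` on `B ⊗̂_A P`. -/
def LeftInduced.lactHom : B →ₐ[ℂ] LeftInduced φ P →L[ℂ] LeftInduced φ P :=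
  HatTensor.actLeft (overBimod φ).ract P.lact (HatBimod.self B).lactHom
    fun b a x => (mul_assoc b x (φ a)).symm

theorem LeftInduced.lactHom_tmul (c b : B) (p : P) :
    LeftInduced.lactHom φ P c (LeftInduced.tmul φ P b p) = LeftInduced.tmul φ P (c * b) p :=
  HatTensor.actLeft_tmul _ _ _ _ _

/-- The left action of `B` on `B ⊗̂_A P ⊗̂_A B`. -/
def Induced.lactHom : B →ₐ[ℂ] Induced φ P →L[ℂ] Induced φ P :=
  HatTensor.actLeft (LeftInduced.ract φ P) (overBimod φ).lact (LeftInduced.lactHom φ P)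
    fun b a z => by
      have h : (LeftInduced.lactHom φ P b).comp (LeftInduced.ract φ P a) =
          (LeftInduced.ract φ P a).comp (LeftInduced.lactHom φ P b) :=
        LeftInduced.ext fun x p => by
          rw [ContinuousLinearMap.comp_apply, ContinuousLinearMap.comp_apply,
            LeftInduced.ract_tmul, LeftInduced.lactHom_tmul, LeftInduced.lactHom_tmul,
            LeftInduced.ract_tmul]
      exact congrArg (fun F => F z) h

/-- The right action of `B` on `B ⊗̂_A P ⊗̂_A B`. -/
def Induced.ractHom : Bᵐᵒᵖ →ₐ[ℂ] Induced φ P →L[ℂ] Induced φ P :=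
  HatTensor.actRight (LeftInduced.ract φ P) (overBimod φ).lact (HatBimod.self B).ractHom
    fun b a x => mul_assoc (φ a) x b.unop

variable {P}

theorem Induced.lactHom_tmul (c b : B) (p : P) (b' : B) :
    Induced.lactHom φ P c (Induced.tmul φ P b p b') = Induced.tmul φ P (c * b) p b' :=
  (HatTensor.actLeft_tmul _ _ _ _ _).trans
    (congrArg (fun z => HatTensor.tmul (LeftInduced.ract φ P) (overBimod φ).lact z b')
      (LeftInduced.lactHom_tmul φ P c b p))

theorem Induced.ractHom_tmul (c : Bᵐᵒᵖ) (b : B) (p : P) (b' : B) :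
    Induced.ractHom φ P c (Induced.tmul φ P b p b') = Induced.tmul φ P b p (b' * c.unop) :=
  HatTensor.actRight_tmul _ _ _ _ _

theorem Induced.map_lactHom (f : HatBimod.Hom P Q) (b : B) (z : Induced φ P) :
    Induced.map φ f (Induced.lactHom φ P b z) = Induced.lactHom φ Q b (Induced.map φ f z) := by
  have h : (Induced.map φ f).comp (Induced.lactHom φ P b) =
      (Induced.lactHom φ Q b).comp (Induced.map φ f) := Induced.ext fun x p y => by
    rw [ContinuousLinearMap.comp_apply, ContinuousLinearMap.comp_apply, Induced.lactHom_tmul,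
      Induced.map_tmul, Induced.map_tmul, Induced.lactHom_tmul]
  exact congrArg (fun F => F z) h

theorem Induced.map_ractHom (f : HatBimod.Hom P Q) (b : Bᵐᵒᵖ) (z : Induced φ P) :
    Induced.map φ f (Induced.ractHom φ P b z) = Induced.ractHom φ Q b (Induced.map φ f z) := by
  have h : (Induced.map φ f).comp (Induced.ractHom φ P b) =
      (Induced.ractHom φ Q b).comp (Induced.map φ f) := Induced.ext fun x p y => by
    rw [ContinuousLinearMap.comp_apply, ContinuousLinearMap.comp_apply, Induced.ractHom_tmul,
      Induced.map_tmul, Induced.map_tmul, Induced.ractHom_tmul]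
  exact congrArg (fun F => F z) h

section Lift

variable {φ} {X : HatBimod B} (f : P →L[ℂ] X) (hl : ∀ (a : A) (p : P), f (a • p) = φ a • f p)
  (hr : ∀ (a : A) (p : P), f (MulOpposite.op a • p) = MulOpposite.op (φ a) • f p)

/-- The map `b ⊗ p ↦ b · f p`. -/
def LeftInduced.lift : LeftInduced φ P →L[ℂ] X :=
  HatTensor.lift (X := overBimod φ)
    (LinearMap.mk₂ ℂ (fun (b : B) (p : P) => b • f p) (fun b c p => add_smul b c _)
      (fun c b p => smul_assoc c b _) (fun b p q => by rw [map_add, smul_add])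
      fun c b p => by rw [map_smul]; exact (X.lact b).map_smul c (f p))
    (show Continuous fun p : B × P => p.1 • f p.2 by fun_prop)
    fun b a p => by
      change (b * φ a) • f p = b • f (a • p)
      rw [hl, mul_smul]

theorem LeftInduced.lift_tmul (b : B) (p : P) :
    LeftInduced.lift f hl (LeftInduced.tmul φ P b p) = b • f p :=
  HatTensor.lift_tmul _ _ _ _ _

/-- The map `b ⊗ p ⊗ b' ↦ b · f p · b'`. -/
def Induced.lift : Induced φ P →L[ℂ] X :=
  HatTensor.lift (Y := overBimod φ)
    (LinearMap.mk₂ ℂ (fun z (b : B) => MulOpposite.op b • LeftInduced.lift f hl z)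
      (fun z w b => by rw [map_add, smul_add])
      (fun c z b => by rw [map_smul]; exact (X.ract b).map_smul c _)
      (fun z b c => add_smul (MulOpposite.op b) (MulOpposite.op c) _)
      fun c z b => smul_assoc c (MulOpposite.op b) _)
    (show Continuous fun p : LeftInduced φ P × B =>
      MulOpposite.op p.2 • LeftInduced.lift f hl p.1 by fun_prop)
    fun z a b => by
      change MulOpposite.op b • LeftInduced.lift f hl (LeftInduced.ract φ P a z) =
        MulOpposite.op (φ a * b) • LeftInduced.lift f hl z
      have h : (LeftInduced.lift f hl).comp (LeftInduced.ract φ P a) =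
          (X.ract (φ a)).comp (LeftInduced.lift f hl) := LeftInduced.ext fun x p => by
        rw [ContinuousLinearMap.comp_apply, ContinuousLinearMap.comp_apply,
          LeftInduced.ract_tmul, LeftInduced.lift_tmul, LeftInduced.lift_tmul, hr,
          HatBimod.ract_apply, smul_comm]
      rw [MulOpposite.op_mul, mul_smul]
      exact congrArg (fun F => MulOpposite.op b • F z) h

theorem Induced.lift_tmul (b : B) (p : P) (b' : B) :
    Induced.lift f hl hr (Induced.tmul φ P b p b') = MulOpposite.op b' • b • f p :=
  (HatTensor.lift_tmul _ _ _ _ _).trans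
    (congrArg (fun x => MulOpposite.op b' • x) (LeftInduced.lift_tmul f hl b p))

theorem Induced.lift_lactHom (b : B) (z : Induced φ P) :
    Induced.lift f hl hr (Induced.lactHom φ P b z) = b • Induced.lift f hl hr z := by
  have h : (Induced.lift f hl hr).comp (Induced.lactHom φ P b) =
      (X.lact b).comp (Induced.lift f hl hr) := Induced.ext fun x p y => by
    rw [ContinuousLinearMap.comp_apply, ContinuousLinearMap.comp_apply, Induced.lactHom_tmul,
      Induced.lift_tmul, Induced.lift_tmul, HatBimod.lact_apply, mul_smul,
      smul_comm b (MulOpposite.op y)]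
  exact congrArg (fun F => F z) h

theorem Induced.lift_ractHom (b : Bᵐᵒᵖ) (z : Induced φ P) :
    Induced.lift f hl hr (Induced.ractHom φ P b z) = b • Induced.lift f hl hr z := by
  have h : (Induced.lift f hl hr).comp (Induced.ractHom φ P b) =
      (X.ract b.unop).comp (Induced.lift f hl hr) := Induced.ext fun x p y => by
    rw [ContinuousLinearMap.comp_apply, ContinuousLinearMap.comp_apply, Induced.ractHom_tmul,
      Induced.lift_tmul, Induced.lift_tmul, HatBimod.ract_apply, MulOpposite.op_mul, mul_smul]
  exact congrArg (fun F => F z) h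

end Lift

end Induced

/-! ### Inner derivations. -/

section Inner

variable {B : Type u} [Ring B] [Algebra ℂ B] [UniformSpace B]

/-- The inner derivation `b ↦ b · x - x · b`. -/
def HatBimod.inner (X : HatBimod B) (x : X) : B →L[ℂ] X where
  toFun b := b • x - MulOpposite.op b • x
  map_add' b c := by rw [MulOpposite.op_add, add_smul, add_smul]; abel
  map_smul' c b := by
    rw [MulOpposite.op_smul, smul_assoc, smul_assoc, RingHom.id_apply, smul_sub]
  cont := by fun_prop

theorem HatBimod.inner_apply (X : HatBimod B) (x : X) (b : B) :
    X.inner x b = b • x - MulOpposite.op b • x := rfl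

theorem HatBimod.inner_mul (X : HatBimod B) (x : X) (b c : B) :
    X.inner x (b * c) = b • X.inner x c + MulOpposite.op c • X.inner x b := by
  simp only [inner_apply, smul_sub, mul_smul, MulOpposite.op_mul,
    smul_comm b (MulOpposite.op c) x, sub_add_sub_cancel]

end Inner

/-! ### Commutators with `1 ⊗ p ⊗ 1` and extension of morphisms. -/

section Commutator

variable {A B : Type u} [Ring A] [Algebra ℂ A] [UniformSpace A]
  [Ring B] [Algebra ℂ B] [UniformSpace B] [HatAlgebra B] {φ : A →A[ℂ] B}

/-- The commutator `b ↦ b · (1 ⊗ p ⊗ 1) - (1 ⊗ p ⊗ 1) · b`. -/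
def Induced.commutator (φ : A →A[ℂ] B) (P : HatBimod A) (p : P) : B →L[ℂ] Induced φ P :=
  (HatTensor.tmulRight (LeftInduced.ract φ P) (overBimod φ).lact (1 : B)).comp
      (HatTensor.tmulRight (overBimod φ).ract P.lact p) -
    HatTensor.tmulLeft (LeftInduced.ract φ P) (overBimod φ).lact (LeftInduced.tmul φ P (1 : B) p)

theorem Induced.commutator_apply {P : HatBimod A} (p : P) (b : B) :
    Induced.commutator φ P p b = Induced.tmul φ P b p 1 - Induced.tmul φ P 1 p b := rfl

/-- The two occurrences of `b ⊗ p ⊗ c` cancel. -/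
theorem Induced.commutator_mul {P : HatBimod A} (p : P) (b c : B) :
    Induced.commutator φ P p (b * c) = Induced.lactHom φ P b (Induced.commutator φ P p c) +
      Induced.ractHom φ P (MulOpposite.op c) (Induced.commutator φ P p b) := by
  simp only [commutator_apply, map_sub, lactHom_tmul, ractHom_tmul, mul_one, one_mul,
    MulOpposite.unop_op, sub_add_sub_cancel]

/-- Elements of `φ(A)` move across the tensor signs into the middle factor. -/
theorem Induced.commutator_map {P : HatBimod A} (p : P) (a : A) :
    Induced.commutator φ P p (φ a) =
      Induced.tmul φ P 1 (a • p - MulOpposite.op a • p) 1 := by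
  rw [commutator_apply, tmul_sub, tmul_smul_left, tmul_smul_right, one_mul, mul_one]

/-- If the tensored sequence splits over `ℂ`, then a bimodule morphism `f : Q → X` with `f ∘ d' = 0`
yields a map on `B ⊗̂_A P ⊗̂_A B` which is a morphism of bimodules on the kernel of the
augmentation. -/
theorem Induced.exists_extension {M P Q S : HatBimod A} {X : HatBimod B} (ε : HatBimod.Hom P M)
    (d : HatBimod.Hom Q P) (d' : HatBimod.Hom S Q) (r : Induced φ M →L[ℂ] Induced φ P)
    (s : Induced φ P →L[ℂ] Induced φ Q) (s' : Induced φ Q →L[ℂ] Induced φ S)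
    (hs : ∀ z, r (Induced.map φ ε z) + Induced.map φ d (s z) = z)
    (hs' : ∀ z, s (Induced.map φ d z) + Induced.map φ d' (s' z) = z)
    (f : Q →L[ℂ] X) (hl : ∀ (a : A) (q : Q), f (a • q) = φ a • f q)
    (hr : ∀ (a : A) (q : Q), f (MulOpposite.op a • q) = MulOpposite.op (φ a) • f q)
    (hf : ∀ w, f (d'.toContinuousLinearMap w) = 0) :
    ∃ ψ : Induced φ P →L[ℂ] X,
      (∀ q, ψ (Induced.tmul φ P 1 (d.toContinuousLinearMap q) 1) = f q) ∧
      (∀ b z, Induced.map φ ε z = 0 → ψ (Induced.lactHom φ P b z) = b • ψ z) ∧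
      ∀ b z, Induced.map φ ε z = 0 → ψ (Induced.ractHom φ P b z) = b • ψ z := by
  let h : Induced φ Q →L[ℂ] X := Induced.lift f hl hr
  have hd (z : Induced φ S) : h (Induced.map φ d' z) = 0 := by
    have : h.comp (Induced.map φ d') = 0 := Induced.ext fun b w b' => by
      rw [ContinuousLinearMap.comp_apply, Induced.map_tmul, Induced.lift_tmul, hf, smul_zero,
        smul_zero]
      rfl
    exact congrArg (fun F => F z) this
  -- The homotopy makes `s` a left inverse of the map induced by `d`, up to the image of the map
  -- induced by `d'`, which `h` kills.
  have hψ (w : Induced φ Q) : h (s (Induced.map φ d w)) = h w := by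
    have := congrArg h (hs' w)
    rwa [map_add, hd, add_zero] at this
  have hker (z : Induced φ P) (hz : Induced.map φ ε z = 0) : Induced.map φ d (s z) = z := by
    have := hs z
    rwa [hz, map_zero, zero_add] at this
  -- The splitting `s` is only linear. On the kernel of the augmentation, however, `z` is the image
  -- of `s z`, and both `h` and the map induced by `d` respect the actions.
  refine ⟨h.comp s, fun q => ?_, fun b z hz => ?_, fun b z hz => ?_⟩
  · rw [← Induced.map_tmul, ContinuousLinearMap.comp_apply, hψ, Induced.lift_tmul,
      MulOpposite.op_one, one_smul, one_smul]
  · rw [← hker z hz, ← Induced.map_lactHom, ContinuousLinearMap.comp_apply,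
      ContinuousLinearMap.comp_apply, hψ, hψ, Induced.lift_lactHom]
  · rw [← hker z hz, ← Induced.map_ractHom, ContinuousLinearMap.comp_apply,
      ContinuousLinearMap.comp_apply, hψ, hψ, Induced.lift_ractHom]

end Commutator

/-! ### Extending a derivation along a homological epimorphism. -/

section ExtendDerivation

variable {A B : Type u} [Ring A] [Algebra ℂ A] [UniformSpace A] [HatAlgebra A]
  [Ring B] [Algebra ℂ B] [UniformSpace B] [HatAlgebra B] {φ : A →A[ℂ] B}

/-- Image of `b ⊗ 1 = 1 ⊗ b` under the map `x ⊗ y ↦ x ⊗ 1 ⊗ y`, which is well defined since `a · 1 =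
1 · a` in `A`. -/
theorem IsHatEpi.induced_tmul_comm (hφ : IsHatEpi φ) (b : B) :
    Induced.tmul φ (HatBimod.self A) b (1 : A) (1 : B) =
      Induced.tmul φ (HatBimod.self A) (1 : B) (1 : A) b := by
  let F : HatTensor (overBimod φ).ract (overBimod φ).lact →L[ℂ] Induced φ (HatBimod.self A) :=
    HatTensor.map (HatTensor.tmulRight (overBimod φ).ract (HatBimod.self A).lact (1 : A))
      (ContinuousLinearMap.id ℂ (overBimod φ))
      (fun a x => by
        refine Eq.trans ?_ (LeftInduced.ract_tmul (P := HatBimod.self A) a x (1 : A)).symm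
        refine (HatTensor.tmul_balanced (ρ := (overBimod φ).ract)
          (σ := (HatBimod.self A).lact) x a (1 : A)).trans ?_
        exact congrArg (LeftInduced.tmul φ (HatBimod.self A) x) ((mul_one a).trans (one_mul a).symm))
      fun _ _ => rfl
  have hF (x y : B) : F (HatTensor.tmul (overBimod φ).ract (overBimod φ).lact x y) =
      Induced.tmul φ (HatBimod.self A) x (1 : A) y := HatTensor.map_tmul _ _ _ _ _ _
  rw [← hF, ← hF, hφ.tmul_one_eq_one_tmul]

/-- The augmentation sends `b ⊗ p ⊗ 1 - 1 ⊗ p ⊗ b` to `b ⊗ 1 ⊗ 1 - 1 ⊗ 1 ⊗ b`. It is here that being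
an epimorphism enters the proof of surjectivity. -/
theorem IsHatEpi.map_commutator (hφ : IsHatEpi φ) {P : HatBimod A}
    (ε : HatBimod.Hom P (HatBimod.self A)) {p : P} (hp : ε.toContinuousLinearMap p = (1 : A))
    (b : B) : Induced.map φ ε (Induced.commutator φ P p b) = 0 := by
  rw [Induced.commutator_apply, map_sub, Induced.map_tmul, Induced.map_tmul, hp,
    hφ.induced_tmul_comm, sub_self]

/-- Continuous derivations extend along homological epimorphisms. -/
theorem IsHomologicalEpi.restrict_surjective (hφ : IsHomologicalEpi φ) (X : HatBimod B) :
    Function.Surjective (Der.restrict φ X) := by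
  intro D
  obtain ⟨hepi, R, r, s, -, hs0, hs⟩ := hφ
  obtain ⟨r', s', hr', hs0', -⟩ := R.splits
  obtain ⟨γ, hγl, hγr⟩ := (R.projective 0).exists_twisted_lift R.ε D
  let d := fun n => (R.d n).toContinuousLinearMap
  have hl (a : A) (q : R.P 1) : (γ.comp (d 0)) (a • q) = φ a • (γ.comp (d 0)) q :=
    (congrArg γ ((R.d 0).map_lsmul a q)).trans (hγl a (d 0 q))
  -- The defect `ε(d q) · D(a)` vanishes because `ε ∘ d = 0`.
  have hr (a : A) (q : R.P 1) :
      (γ.comp (d 0)) (MulOpposite.op a • q) = MulOpposite.op (φ a) • (γ.comp (d 0)) q := by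
    refine (congrArg γ ((R.d 0).map_rsmul a q)).trans ((hγr a (d 0 q)).trans ?_)
    have h0 : R.ε.toContinuousLinearMap (d 0 q) = (0 : A) := R.ε_d q
    rw [h0, zero_smul, add_zero]
    rfl
  obtain ⟨ψ, hψ, hψl, hψr⟩ := Induced.exists_extension R.ε (R.d 0) (R.d 1) r (s 0) (s 1) hs0 (hs 0)
    (X := X) (γ.comp (d 0)) hl hr fun w => (congrArg γ (R.d_d 0 w)).trans (map_zero γ)
  let p : R.P 0 := r' (1 : A)
  have hp : R.ε.toContinuousLinearMap p = (1 : A) := hr' _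
  have hc := hepi.map_commutator R.ε hp
  -- On `A` the inner derivation of `γ p` differs from `a ↦ γ(a·p - p·a)` by exactly `D`; the term
  -- with `ψ` continues the latter map to `B`.
  refine ⟨⟨X.inner (γ p) - ψ.comp (Induced.commutator φ (R.P 0) p), fun b c => ?_⟩,
    Subtype.ext (ContinuousLinearMap.ext fun a => ?_)⟩
  · simp only [sub_apply, ContinuousLinearMap.comp_apply, X.inner_mul, Induced.commutator_mul,
      map_add, hψl _ _ (hc _), hψr _ _ (hc _), smul_sub]
    abel
  · change X.inner (γ p) (φ a) - ψ (Induced.commutator φ (R.P 0) p (φ a)) = D.1 a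
    let w : R.P 0 := a • p - MulOpposite.op a • p
    have hw : R.ε.toContinuousLinearMap w = (0 : A) := by
      have h1 : R.ε.toContinuousLinearMap (a • p) = a * R.ε.toContinuousLinearMap p :=
        R.ε.map_lsmul a p
      have h2 : R.ε.toContinuousLinearMap (MulOpposite.op a • p) =
          (R.ε.toContinuousLinearMap p : A) * a := R.ε.map_rsmul a p
      rw [map_sub, h1, h2, hp, mul_one, one_mul, sub_self]
    -- This uses the splitting of the original resolution, not of the tensored sequence: `ψ` is
    -- known on `1 ⊗ v ⊗ 1` only for `v` in the image of `d 0`.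
    obtain ⟨q, hq⟩ : ∃ q, d 0 q = w := ⟨s' 0 w, by
      have := hs0' w
      rwa [hw, map_zero, zero_add] at this⟩
    have hψw : ψ (Induced.commutator φ (R.P 0) p (φ a)) = γ w := by
      rw [Induced.commutator_map]
      refine (congrArg (fun v => ψ (Induced.tmul φ (R.P 0) 1 v 1)) hq.symm).trans ((hψ q).trans ?_)
      exact congrArg γ hq
    have hγw : γ w = φ a • γ p - (MulOpposite.op (φ a) • γ p + D.1 a) := by
      refine (map_sub γ _ _).trans ?_
      rw [hγl, hγr, hp, one_smul]
      rfl
    rw [hψw, hγw, X.inner_apply]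
    abel

end ExtendDerivation

end

theorem mainTheorem4 {A B : Type u}
    [Ring A] [Algebra ℂ A] [UniformSpace A] [HatAlgebra A]
    [Ring B] [Algebra ℂ B] [UniformSpace B] [HatAlgebra B]
    (φ : A →A[ℂ] B) (hφ : IsHomologicalEpi φ) : PropertyUDE φ :=
  fun X => ⟨hφ.1.restrict_injective X, hφ.restrict_surjective X⟩
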